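/- Let $p_1=0,\ p_2=1,\ p_3=e^{\pi i/3}$ in $\mathbb C$, $F_i(x)=\tfrac12(x-p_i)+p_i$, let $K$ be the Sierpiński gasket (the unique nonempty compact set with $K=\bigcup_{i=1}^3F_i(K)$), and let $\mu$ be the normalized $\frac{\log 3}{\log 2}$-dimensional Hausdorff measure on $K$. For a word $\omega=\omega_1\cdots\omega_n\in W_n=\{1,2,3\}^n$ put $F_\omega=F_{\omega_1}\circ\cdots\circ F_{\omega_n}$ and $u_\omega=u\circ F_\omega$. Put $\phi(x;y,z)=\frac{(x+y)(x+z)}{2(x+y+z)}$. Let $x_0>y_0=z_0>0$. There is exactly one sequence of triples $(x_n,y_n,z_n)_{n\ge0}$ of positive numbers starting from $(x_0,y_0,z_0)$ such that for all $n\ge1$ $$x_{n-1}=x_n+\phi(x_n;y_n,z_n),\quad y_{n-1}=y_n+\phi(y_n;z_n,x_n),\quad z_{n-1}=z_n+\phi(z_n;x_n,y_n).$$ Let $r_n=x_ny_n+y_nz_n+z_nx_n$, $(a_n,b_n,c_n)=(x_n,y_n,z_n)/r_n$ and, for $u\in C(K)$, $$\mathcal E_n^{(a_0,b_0)}(u)=\sum_{\omega\in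 W_n}\Big(a_n\big(u_\omega(p_2)-u_\omega(p_3)\big)^2+b_n\big(u_\omega(p_1)-u_\omega(p_3)\big)^2+c_n\big(u_\omega(p_1)-u_\omega(p_2)\big)^2\Big).$$ Then $a_0>b_0=c_0$, and for all $n\ge0$ $$a_n=\frac{x_n}{y_n(2x_n+y_n)},\qquad b_n=c_n=\frac1{2x_n+y_n},$$ and $a_n\asymp 2^n$, $b_n=c_n\asymp(3/2)^n$, where $f_n\asymp g_n$ means that $f_n\le Cg_n$ and $g_n\le Cf_n$ for all $n\geq 0$ with some constant $C>0$. Moreover $\mathcal E^{(a_0,b_0)}(u)=\lim_{n\to\infty}\mathcal E_n^{(a_0,b_0)}(u)\in[0,\infty]$ exists for every $u\in C(K)$ and defines a strongly local regular Dirichlet form on $L^2(K,\mu)$ with domain $\mathcal F=\{u\in C(K):\mathcal E^{(a_0,b_0)}(u)<\infty\}$, and $\mathcal F$ is the same for all such initial data $(a_0,b_0)$. It satisfies $$\mathcal E^{(a_0,b_0)}(u)=\sum_{i=1}^3\mathcal E^{(a_1,b_1)}(u\circ F_i)\qquad(u\in C(K)),$$ where $\mathcal E^{(a_1,b_1)}$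 is the form constructed in the same way from the initial data $(x_1,y_1,z_1)$, but it does not satisfy the energy self-similar identity: there are no positive numbers $r_1,r_2,r_3$ with $\mathcal E^{(a_0,b_0)}(u)=\sum_{i=1}^3\frac1{r_i}\mathcal E^{(a_0,b_0)}(u\circ F_i)$ for all $u\in\mathcal F$. -/

import Mathlib

open MeasureTheory Filter Topology TopologicalSpace
open scoped ENNReal NNReal

noncomputable section

/-! ### Dirichlet forms on an `L²` space -/

/-- A (symmetric) Dirichlet form on `L²(X, m)`: a densely defined, symmetric, nonnegative,
closed, Markovian bilinear form. -/
structure DirichletForm (X : Type*) [MeasurableSpace X] (m : Measure X) where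
  /-- the domain of the form -/
  domain : Submodule ℝ (Lp ℝ 2 m)
  /-- the form -/
  form : domain →ₗ[ℝ] domain →ₗ[ℝ] ℝ
  dense_domain : Dense (domain : Set (Lp ℝ 2 m))
  symm : ∀ u v, form u v = form v u
  nonneg : ∀ u, 0 ≤ form u u
  /-- closedness: the domain is complete for `𝓔₁(u) = 𝓔(u, u) + ‖u‖²` -/
  closed : ∀ s : ℕ → domain,
    (∀ ε > 0, ∃ N, ∀ j ≥ N, ∀ k ≥ N,
      form (s j - s k) (s j - s k) + ‖s j - s k‖ ^ 2 < ε) →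
    ∃ u : domain,
      Tendsto (fun n => form (s n - u) (s n - u) + ‖s n - u‖ ^ 2) atTop (𝓝 0)
  /-- the unit contraction operates -/
  markov : ∀ u : domain, ∃ v : domain,
    ((v : Lp ℝ 2 m) : X → ℝ) =ᵐ[m] (fun x => min (max ((u : Lp ℝ 2 m) x) 0) 1) ∧
      form v v ≤ form u u

namespace DirichletForm

variable {X : Type*} [TopologicalSpace X] [MeasurableSpace X] {m : Measure X}

/-- `f` is (a representative of) an element of the domain. -/
def Represents (D : DirichletForm X m) (f : X → ℝ) (v : D.domain) : Prop :=
  ((v : Lp ℝ 2 m) : X → ℝ) =ᵐ[m] f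

/-- Regularity: `𝓕 ∩ C_c(X)` is dense in `𝓕` for the `𝓔₁`-norm and dense in `C_c(X)` for the
uniform norm. -/
def IsRegular (D : DirichletForm X m) : Prop :=
  (∀ u : D.domain, ∀ ε > 0, ∃ (f : CompactlySupportedContinuousMap X ℝ) (v : D.domain),
    D.Represents f v ∧ D.form (u - v) (u - v) + ‖u - v‖ ^ 2 < ε) ∧
  (∀ g : CompactlySupportedContinuousMap X ℝ, ∀ ε > 0,
    ∃ (f : CompactlySupportedContinuousMap X ℝ) (v : D.domain),
      D.Represents f v ∧ ∀ x, |g x - f x| < ε)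

/-- The support of a class `u ∈ L²(X, m)`: the support of the measure `|u| • m`. -/
def supp (u : Lp ℝ 2 m) : Set X :=
  (m.withDensity fun x => ‖u x‖ₑ).support

/-- Strong locality: `𝓔(u, v) = 0` whenever `u, v ∈ 𝓕` have compact supports and `v` is constant
on a neighbourhood of the support of `u`. -/
def IsStronglyLocal (D : DirichletForm X m) : Prop :=
  ∀ u v : D.domain, IsCompact (supp (u : Lp ℝ 2 m)) → IsCompact (supp (v : Lp ℝ 2 m)) →
    (∃ (U : Set X) (k : ℝ), IsOpen U ∧ supp (u : Lp ℝ 2 m) ⊆ U ∧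
      ∀ᵐ x ∂m, x ∈ U → (v : Lp ℝ 2 m) x = k) →
    D.form u v = 0

end DirichletForm

namespace SG

/-! ### The Sierpiński gasket -/

/-- The points `p₁ = 0`, `p₂ = 1`, `p₃ = exp(π i / 3)`, indexed by `0, 1, 2 : Fin 3`. -/
def p : Fin 3 → ℂ := ![0, 1, Complex.exp (Real.pi * Complex.I / 3)]

/-- The contractions `F_i(x) = (x - p_i) / 2 + p_i` of the plane. -/
def planeMap (i : Fin 3) (x : ℂ) : ℂ := (1 / 2) * (x - p i) + p i

theorem continuous_planeMap (i : Fin 3) : Continuous (planeMap i) := by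
  unfold planeMap; fun_prop

theorem dist_planeMap (i : Fin 3) (x y : ℂ) :
    dist (planeMap i x) (planeMap i y) = (1 / 2) * dist x y := by
  have h : planeMap i x - planeMap i y = (1 / 2) * (x - y) := by unfold planeMap; ring
  rw [dist_eq_norm, h, norm_mul, dist_eq_norm]
  norm_num

theorem edist_planeMap (i : Fin 3) (x y : ℂ) :
    edist (planeMap i x) (planeMap i y) = ((1 / 2 : ℝ≥0) : ℝ≥0∞) * edist x y := by
  rw [edist_dist, dist_planeMap, edist_dist, ENNReal.ofReal_mul (by norm_num)]
  congr 1
  rw [ENNReal.ofReal, Real.toNNReal_of_nonneg (by norm_num)]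
  congr 1

/-- The Hutchinson operator `A ↦ F₁(A) ∪ F₂(A) ∪ F₃(A)` on nonempty compact sets. -/
def hutchinson (A : NonemptyCompacts ℂ) : NonemptyCompacts ℂ :=
  A.map _ (continuous_planeMap 0) ⊔
    (A.map _ (continuous_planeMap 1) ⊔ A.map _ (continuous_planeMap 2))

theorem coe_hutchinson (A : NonemptyCompacts ℂ) :
    (hutchinson A : Set ℂ) = ⋃ i, planeMap i '' (A : Set ℂ) := by
  ext x
  simp [hutchinson, Fin.exists_fin_succ]

theorem edist_map_planeMap (i : Fin 3) (A B : NonemptyCompacts ℂ) :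
    edist (A.map _ (continuous_planeMap i)) (B.map _ (continuous_planeMap i)) ≤
      ((1 / 2 : ℝ≥0) : ℝ≥0∞) * edist A B := by
  have key : ∀ A B : NonemptyCompacts ℂ, ∀ x ∈ planeMap i '' (A : Set ℂ),
      Metric.infEDist x (planeMap i '' (B : Set ℂ)) ≤
        ((1 / 2 : ℝ≥0) : ℝ≥0∞) * Metric.hausdorffEDist (A : Set ℂ) B := by
    rintro A B _ ⟨x, hx, rfl⟩
    obtain ⟨y, hy, hxy⟩ := B.isCompact.exists_infEDist_eq_edist B.nonempty x
    calc _ ≤ edist (planeMap i x) (planeMap i y) :=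
          Metric.infEDist_le_edist_of_mem (Set.mem_image_of_mem _ hy)
      _ = _ * Metric.infEDist x B := by rw [edist_planeMap, hxy]
      _ ≤ _ := by gcongr; exact Metric.infEDist_le_hausdorffEDist_of_mem hx
  refine Metric.hausdorffEDist_le_of_infEDist (key A B) fun x hx => ?_
  have h := key B A x hx
  rwa [Metric.hausdorffEDist_comm] at h

theorem contracting_hutchinson : ContractingWith (1 / 2) hutchinson := by
  refine ⟨by norm_num [← NNReal.coe_lt_coe], fun A B => ?_⟩
  have sup_le : ∀ A B C D : NonemptyCompacts ℂ,
      edist (A ⊔ B) (C ⊔ D) ≤ max (edist A C) (edist B D) :=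
    fun A B C D => Metric.hausdorffEDist_union_le
  refine (sup_le _ _ _ _).trans (max_le (edist_map_planeMap 0 A B) ?_)
  exact (sup_le _ _ _ _).trans (max_le (edist_map_planeMap 1 A B) (edist_map_planeMap 2 A B))

/-- There is exactly one nonempty compact set `K` with `K = F₁(K) ∪ F₂(K) ∪ F₃(K)`. -/
theorem existsUnique_gasket :
    ∃! A : NonemptyCompacts ℂ, (A : Set ℂ) = ⋃ i, planeMap i '' (A : Set ℂ) := by
  have : Nonempty (NonemptyCompacts ℂ) := ⟨⟨⟨{0}, isCompact_singleton⟩, ⟨0, rfl⟩⟩⟩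
  have iff_fixed : ∀ A : NonemptyCompacts ℂ,
      ((A : Set ℂ) = ⋃ i, planeMap i '' (A : Set ℂ)) ↔ Function.IsFixedPt hutchinson A := by
    intro A
    rw [← coe_hutchinson, SetLike.coe_set_eq, eq_comm]
    rfl
  refine ⟨ContractingWith.fixedPoint _ contracting_hutchinson, ?_, fun A hA => ?_⟩
  · exact (iff_fixed _).2 contracting_hutchinson.fixedPoint_isFixedPt
  · exact contracting_hutchinson.fixedPoint_unique ((iff_fixed A).1 hA)

/-- The Sierpiński gasket, as a subset of the plane. -/
def gasket : NonemptyCompacts ℂ := existsUnique_gasket.choose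

theorem gasket_eq : (gasket : Set ℂ) = ⋃ i, planeMap i '' (gasket : Set ℂ) :=
  existsUnique_gasket.choose_spec.1

/-- The Sierpiński gasket as a (compact metric) space. -/
abbrev K : Type := (gasket : Set ℂ)

instance : CompactSpace K := isCompact_iff_compactSpace.1 gasket.isCompact

theorem planeMap_mem (i : Fin 3) {x : ℂ} (hx : x ∈ (gasket : Set ℂ)) :
    planeMap i x ∈ (gasket : Set ℂ) := by
  rw [gasket_eq]
  exact Set.mem_iUnion.2 ⟨i, x, hx, rfl⟩

theorem p_mem (i : Fin 3) : p i ∈ (gasket : Set ℂ) := by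
  obtain ⟨x, hx⟩ := gasket.nonempty
  have hmem : ∀ n : ℕ, p i + (1 / 2 : ℂ) ^ n * (x - p i) ∈ (gasket : Set ℂ) := by
    intro n
    induction n with
    | zero => simpa using hx
    | succ n ih =>
      have h := planeMap_mem i ih
      have e : planeMap i (p i + (1 / 2 : ℂ) ^ n * (x - p i)) =
          p i + (1 / 2 : ℂ) ^ (n + 1) * (x - p i) := by unfold planeMap; ring
      rwa [e] at h
  have hlim : Tendsto (fun n : ℕ => p i + (1 / 2 : ℂ) ^ n * (x - p i)) atTop (𝓝 (p i)) := by
    have h0 : Tendsto (fun n : ℕ => (1 / 2 : ℂ) ^ n) atTop (𝓝 0) :=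
      tendsto_pow_atTop_nhds_zero_of_norm_lt_one (by norm_num)
    simpa using (h0.mul_const (x - p i)).const_add (p i)
  exact gasket.isCompact.isClosed.mem_of_tendsto hlim (Eventually.of_forall hmem)

/-- The boundary points `p_i` as points of `K`. -/
def vertex (i : Fin 3) : K := ⟨p i, p_mem i⟩

/-- The maps `F_i : K → K`. -/
def F (i : Fin 3) : C(K, K) where
  toFun x := ⟨planeMap i x, planeMap_mem i x.2⟩
  continuous_toFun := ((continuous_planeMap i).comp continuous_subtype_val).subtype_mk _

/-- `F_ω = F_{ω₁} ∘ ⋯ ∘ F_{ωₙ}` for a word `ω ∈ W_n = {1, 2, 3}ⁿ`. -/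
def wordMap : (n : ℕ) → (Fin n → Fin 3) → C(K, K)
  | 0, _ => ContinuousMap.id K
  | n + 1, ω => (F (ω 0)).comp (wordMap n (Fin.tail ω))

/-- The Hausdorff measure on `K` of dimension `α = log 3 / log 2`. -/
def hausdorff : Measure K := μH[Real.log 3 / Real.log 2]

/-- The normalized `α`-Hausdorff measure on `K`. -/
def μ : Measure K := (hausdorff Set.univ)⁻¹ • hausdorff

instance : IsFiniteMeasure μ :=
  ⟨by
    rw [μ, Measure.smul_apply, smul_eq_mul]
    exact (ENNReal.inv_mul_le_one _).trans_lt ENNReal.one_lt_top⟩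

/-! ### The recursive construction -/

/-- `φ(x; y, z) = (x + y)(x + z) / (2 (x + y + z))`. -/
def φ (x y z : ℝ) : ℝ := (x + y) * (x + z) / (2 * (x + y + z))

/-- `(x_n, y_n, z_n)`, `n ≥ 0`, are the positive resistances, on the `Y`-side, of a recursive
construction of compatible networks: the `Y`-network equivalent to the three `Y`-networks of
level `n + 1` glued together is the one of level `n`. -/
structure IsRecursive (x y z : ℕ → ℝ) : Prop where
  x_pos : ∀ n, 0 < x n
  y_pos : ∀ n, 0 < y n
  z_pos : ∀ n, 0 < z n
  x_eq : ∀ n, x n = x (n + 1) + φ (x (n + 1)) (y (n + 1)) (z (n + 1))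
  y_eq : ∀ n, y n = y (n + 1) + φ (y (n + 1)) (z (n + 1)) (x (n + 1))
  z_eq : ∀ n, z n = z (n + 1) + φ (z (n + 1)) (x (n + 1)) (y (n + 1))

/-- The `Δ`-`Y` transform: in the `Δ`-network equivalent to the `Y`-network with resistances
`x, y, z` at the three vertices, the conductance of the edge opposite to the vertex of `x` is
`x / (xy + yz + zx)`, and cyclically. -/
def conductance (x y z : ℝ) : ℝ := x / (x * y + y * z + z * x)

/-- `E_n(u) = ∑_{p ∼ₙ q} c_{pq} (u(p) - u(q))²`, where on every cell `F_ω(V₀)`, `|ω| = n`, the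
conductances of the edges opposite to `F_ω(p₁)`, `F_ω(p₂)`, `F_ω(p₃)` are `a`, `b`, `c`. -/
def graphEnergy (a b c : ℝ) (n : ℕ) (u : C(K, ℝ)) : ℝ :=
  ∑ ω : Fin n → Fin 3,
    (a * (u (wordMap n ω (vertex 1)) - u (wordMap n ω (vertex 2))) ^ 2 +
      b * (u (wordMap n ω (vertex 0)) - u (wordMap n ω (vertex 2))) ^ 2 +
      c * (u (wordMap n ω (vertex 0)) - u (wordMap n ω (vertex 1))) ^ 2)

/-- `E_n` for the `n`-th conductances `(a_n, b_n, c_n)` of the recursive construction. -/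
def levelEnergy (x y z : ℕ → ℝ) (n : ℕ) (u : C(K, ℝ)) : ℝ :=
  graphEnergy (conductance (x n) (y n) (z n)) (conductance (y n) (z n) (x n))
    (conductance (z n) (x n) (y n)) n u

/-- The energy `E(u) = lim_n E_n(u) ∈ [0, ∞]` of `u ∈ C(K)`. -/
def energy (x y z : ℕ → ℝ) (u : C(K, ℝ)) : ℝ≥0∞ :=
  limUnder atTop fun n => ENNReal.ofReal (levelEnergy x y z n u)

/-- The domain `𝓕 = {u ∈ C(K) : E(u) < ∞}` of an energy functional. -/
def finiteEnergy (E : C(K, ℝ) → ℝ≥0∞) : Set C(K, ℝ) := {u | E u < ∞}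

/-- The Dirichlet form `D` on `L²(K, μ)` is the one given by the energy functional `E` on `C(K)`:
its domain is `𝓕` and its quadratic form is `E` there. -/
def IsFormOf (D : DirichletForm K μ) (E : C(K, ℝ) → ℝ≥0∞) : Prop :=
  (D.domain : Set (Lp ℝ 2 μ)) = ContinuousMap.toLp 2 μ ℝ '' finiteEnergy E ∧
  ∀ u ∈ finiteEnergy E, ∀ hu : ContinuousMap.toLp 2 μ ℝ u ∈ D.domain,
    D.form ⟨ContinuousMap.toLp 2 μ ℝ u, hu⟩ ⟨ContinuousMap.toLp 2 μ ℝ u, hu⟩ = (E u).toReal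

/-- The energy self-similar identity `E(u) = ∑ᵢ rᵢ⁻¹ E(u ∘ F_i)`, `u ∈ 𝓕`, holds for some positive
renormalization factors `r₁, r₂, r₃`. -/
def IsSelfSimilar (E : C(K, ℝ) → ℝ≥0∞) : Prop :=
  ∃ r : Fin 3 → ℝ, (∀ i, 0 < r i) ∧
    ∀ u ∈ finiteEnergy E, E u = ∑ i, ENNReal.ofReal (1 / r i) * E (u.comp (F i))

/-- `f ≍ g`: each of two nonnegative sequences is dominated by a positive constant times the
other. -/
def Comparable (f g : ℕ → ℝ) : Prop :=
  ∃ C > 0, ∀ n, f n ≤ C * g n ∧ g n ≤ C * f n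

end SG

end

/-! Growth. With `y = z` everything is governed by the excess `s = x / y - 1`. Passing from level
`n` to level `n + 1` multiplies `s` by `(4x + 6y) / (3x + 5y)`, taken at level `n + 1`, which
exceeds `5/4` because `x > y`. So `s` grows geometrically, while `y` and `x` are multiplied by `1/2`
and `2/3` up to relative errors at most of order `1 / s`, which are summable. The conductances are
comparable to `1 / y` and `1 / x`, whence `2 ^ n` and `(3/2) ^ n`.

Limit. On the Δ-side the recursion says that the triangle of level `n` is the trace of three glued
triangles of level `n + 1`. Completing squares in the values at the midpoints (`triangle_energy_le`)
makes the graph energies nondecreasing, so the limit exists. By the growth rates, finite energy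
means bounded energies for the coefficients `2 ^ n`, `(3/2) ^ n` (`finiteEnergySubmodule`), which is
the same condition for all initial data.

Dirichlet form. Every edge of level `n` has conductance at least of order `(3/2) ^ n`, so chaining
bounds the oscillation of `u` by a multiple of the root of its energy (`exists_abs_sub_le`). Hence
Cauchy sequences for the form norm converge uniformly, and the monotone graph energies give lower
semicontinuity, hence closedness. Two explicit self-affine functions, `height` and `tilt`, have
finite energy and, with the constants, interpolate any boundary values; gluing them over small cells
gives uniform density. Locality holds because small cells cannot see variation of both functions.
Identifying classes in `L²` with continuous functions needs `μ` to charge open sets, which is a mass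
distribution argument.

No self-similarity. If the identity held with factors `ρ i = 1 / r i`, then testing it on extensions
by zero from the first cell would force the energy shifted by `m` levels to be `ρ 0 ^ m` times the
original one on functions vanishing at the boundary. But a function with a jump along an `a`-edge
has shifted energy at least of order `2 ^ m`, while a function of the height has at most of order
`(3/2) ^ m` (`not_exists_renormalization`). -/

namespace SG

/-! ### Geometry of the gasket -/

/-- The barycentric coordinates of the plane with respect to `p₁, p₂, p₃`. -/
noncomputable def bary (i : Fin 3) (z : ℂ) : ℝ :=
  ![1 - z.re - z.im / √3, z.re - z.im / √3, 2 * z.im / √3] i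

theorem p_two : p 2 = ⟨1 / 2, √3 / 2⟩ := by
  have h : (Real.pi * Complex.I / 3 : ℂ) = ((Real.pi / 3 : ℝ) : ℂ) * Complex.I := by
    push_cast; ring
  apply Complex.ext
  · simp only [p, Matrix.cons_val, h, Complex.exp_ofReal_mul_I_re, Real.cos_pi_div_three]
  · simp only [p, Matrix.cons_val, h, Complex.exp_ofReal_mul_I_im, Real.sin_pi_div_three]

theorem bary_p (i j : Fin 3) : bary j (p i) = if i = j then 1 else 0 := by
  have h3 : √3 ≠ 0 := by positivity
  fin_cases i
  · fin_cases j <;> simp [bary, p]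
  · fin_cases j <;> simp [bary, p]
  · show bary j (p 2) = _
    rw [p_two]
    fin_cases j <;> simp [bary] <;> field_simp <;> norm_num

theorem bary_planeMap (i j : Fin 3) (z : ℂ) :
    bary j (planeMap i z) = (bary j z + if i = j then 1 else 0) / 2 := by
  have key : bary j (planeMap i z) = (bary j z + bary j (p i)) / 2 := by
    have hre : (planeMap i z).re = (z.re + (p i).re) / 2 := by
      simp [planeMap]; ring
    have him : (planeMap i z).im = (z.im + (p i).im) / 2 := by
      simp [planeMap]; ring
    fin_cases j <;> simp [bary, hre, him] <;> ring
  rw [key, bary_p]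

theorem bary_sum (z : ℂ) : bary 0 z + bary 1 z + bary 2 z = 1 := by
  simp [bary]; ring

theorem eq_of_bary_eq {z w : ℂ} (h : ∀ j, bary j z = bary j w) : z = w := by
  have h1 := h 1
  have h2 := h 2
  have h3 : √3 ≠ 0 := by positivity
  simp only [bary, Matrix.cons_val] at h1 h2
  have him : z.im = w.im := by field_simp at h2; linarith
  rw [him] at h1
  exact Complex.ext (by linarith) him

theorem continuous_bary (j : Fin 3) : Continuous (bary j) := by
  fin_cases j <;> unfold bary <;> simp only [Fin.zero_eta, Fin.mk_one, Fin.reduceFinMk,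
    Matrix.cons_val] <;> fun_prop

theorem abs_bary_sub_le (j : Fin 3) (z w : ℂ) : |bary j z - bary j w| ≤ 2 * dist z w := by
  have h1 : (1 : ℝ) ≤ √3 := Real.one_le_sqrt.2 (by norm_num)
  have hre : |(z - w).re| ≤ dist z w := by rw [dist_eq_norm]; exact Complex.abs_re_le_norm _
  have him : |(z - w).im| ≤ dist z w := by rw [dist_eq_norm]; exact Complex.abs_im_le_norm _
  have him' : |(z - w).im / √3| ≤ dist z w := by
    rw [abs_div, abs_of_pos (by positivity : 0 < √3)]
    exact (div_le_self (abs_nonneg _) h1).trans him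
  rw [abs_le] at hre him' ⊢
  have e : (z - w).im / √3 = z.im / √3 - w.im / √3 := by simp; ring
  rw [e] at him'
  simp only [Complex.sub_re] at hre
  fin_cases j <;> simp only [bary, Fin.zero_eta, Fin.mk_one, Fin.reduceFinMk, Matrix.cons_val,
    mul_div_assoc] <;> constructor <;> linarith [hre.1, hre.2, him'.1, him'.2]

theorem exists_planeMap_eq {z : ℂ} (hz : z ∈ (gasket : Set ℂ)) :
    ∃ i, ∃ w ∈ (gasket : Set ℂ), planeMap i w = z := by
  rw [gasket_eq] at hz
  simpa using hz

/-- At a point `F_i w` where the minimum over the gasket is attained, the coordinate is at least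
half its value at `w`, hence at least half the minimum. So the minimum is nonnegative. -/
theorem bary_nonneg (j : Fin 3) {z : ℂ} (hz : z ∈ (gasket : Set ℂ)) : 0 ≤ bary j z := by
  obtain ⟨m, hm, hmin⟩ := gasket.isCompact.exists_isMinOn gasket.nonempty
    (continuous_bary j).continuousOn
  refine le_trans ?_ (hmin hz)
  obtain ⟨i, w, hw, rfl⟩ := exists_planeMap_eq hm
  have h1 : bary j (planeMap i w) ≤ bary j w := hmin hw
  have h2 := bary_planeMap i j w
  split_ifs at h2 <;> linarith

theorem bary_le_one (j : Fin 3) {z : ℂ} (hz : z ∈ (gasket : Set ℂ)) : bary j z ≤ 1 := by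
  have h := bary_sum z
  have h0 := bary_nonneg 0 hz
  have h1 := bary_nonneg 1 hz
  have h2 := bary_nonneg 2 hz
  fin_cases j <;> simp only [Fin.zero_eta, Fin.mk_one, Fin.reduceFinMk] <;> linarith

theorem eq_p_of_bary_eq_one {j : Fin 3} {z : ℂ} (hz : z ∈ (gasket : Set ℂ)) (h : 1 ≤ bary j z) :
    z = p j := by
  have hs := bary_sum z
  have h0 := bary_nonneg 0 hz
  have h1 := bary_nonneg 1 hz
  have h2 := bary_nonneg 2 hz
  apply eq_of_bary_eq
  intro k
  rw [bary_p]
  fin_cases j <;> fin_cases k <;> simp at h ⊢ <;> linarith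

theorem F_coe (i : Fin 3) (x : K) : (F i x : ℂ) = planeMap i x := rfl

/-- The `j`-th coordinate is at most `1/2` on the cell `i` and at least `1/2` on the cell `j`, so at
a common point it is `1/2`. This forces the coordinate `1` before contraction, which only the vertex
has. -/
theorem F_eq_F {i j : Fin 3} (hij : i ≠ j) {x y : K} (h : F i x = F j y) :
    x = vertex j ∧ y = vertex i := by
  have h' : planeMap i x = planeMap j y := congrArg Subtype.val h
  constructor
  · have e : bary j (planeMap i x) = bary j (planeMap j y) := by rw [h']
    rw [bary_planeMap, bary_planeMap, if_neg hij, if_pos rfl] at e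
    exact Subtype.ext (eq_p_of_bary_eq_one x.2 (by linarith [bary_nonneg j y.2]))
  · have e : bary i (planeMap i x) = bary i (planeMap j y) := by rw [h']
    rw [bary_planeMap, bary_planeMap, if_neg hij.symm, if_pos rfl] at e
    exact Subtype.ext (eq_p_of_bary_eq_one y.2 (by linarith [bary_nonneg i x.2]))

theorem F_vertex_comm (i j : Fin 3) : F i (vertex j) = F j (vertex i) := by
  apply Subtype.ext
  simp only [F_coe, planeMap, vertex]
  ring

theorem F_vertex_self (i : Fin 3) : F i (vertex i) = vertex i := by
  apply Subtype.ext
  simp only [F_coe, planeMap, vertex]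
  ring

theorem exists_F_eq (x : K) : ∃ i y, F i y = x := by
  obtain ⟨i, w, hw, h⟩ := exists_planeMap_eq x.2
  exact ⟨i, ⟨w, hw⟩, Subtype.ext h⟩

theorem F_injective (i : Fin 3) : Function.Injective (F i) := by
  intro x y h
  have h' : planeMap i x = planeMap i y := congrArg Subtype.val h
  apply Subtype.ext
  simp only [planeMap] at h'
  linear_combination 2 * h'

/-- Continuous functions on the three cells that agree at the common vertices can be glued. -/
theorem exists_glue (v : Fin 3 → C(K, ℝ)) (hv : ∀ i j, v i (vertex j) = v j (vertex i)) :
    ∃ u : C(K, ℝ), ∀ i, u.comp (F i) = v i := by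
  let f : C(Fin 3 × K, K) :=
    ⟨fun q => F q.1 q.2, continuous_prod_of_discrete_left.2 fun i => (F i).continuous⟩
  let g : C(Fin 3 × K, ℝ) :=
    ⟨fun q => v q.1 q.2, continuous_prod_of_discrete_left.2 fun i => (v i).continuous⟩
  -- `K` is the quotient of three disjoint copies of itself: a continuous surjection from a compact
  -- space to a Hausdorff space is closed. By `F_eq_F` only the common vertices are identified.
  have hf : IsQuotientMap f := by
    refine IsClosedMap.isQuotientMap f.continuous.isClosedMap f.continuous fun x => ?_
    obtain ⟨i, y, h⟩ := exists_F_eq x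
    exact ⟨(i, y), h⟩
  have hg : Function.FactorsThrough g f := by
    rintro ⟨i, x⟩ ⟨j, y⟩ h
    change F i x = F j y at h
    change v i x = v j y
    by_cases hij : i = j
    · subst hij
      rw [F_injective i h]
    · obtain ⟨rfl, rfl⟩ := F_eq_F hij h
      exact hv i j
  refine ⟨hf.lift g hg, fun i => ?_⟩
  ext x
  exact DFunLike.congr_fun (IsQuotientMap.lift_comp hf g hg) (i, x)

theorem wordMap_succ {n : ℕ} (ω : Fin (n + 1) → Fin 3) (x : K) :
    wordMap (n + 1) ω x = F (ω 0) (wordMap n (Fin.tail ω) x) := rfl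

theorem wordMap_cons {n : ℕ} (i : Fin 3) (ω : Fin n → Fin 3) (x : K) :
    wordMap (n + 1) (Fin.cons i ω) x = F i (wordMap n ω x) := by
  rw [wordMap_succ, Fin.cons_zero, Fin.tail_cons]

theorem dist_F (i : Fin 3) (x y : K) : dist (F i x) (F i y) = (1 / 2) * dist x y := by
  simp only [Subtype.dist_eq, F_coe, dist_planeMap]

theorem dist_wordMap {n : ℕ} (ω : Fin n → Fin 3) (x y : K) :
    dist (wordMap n ω x) (wordMap n ω y) = (1 / 2) ^ n * dist x y := by
  induction n with
  | zero => simp [wordMap]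
  | succ n ih => rw [wordMap_succ, wordMap_succ, dist_F, ih]; ring

theorem exists_wordMap_eq (n : ℕ) (x : K) : ∃ ω y, wordMap n ω y = x := by
  induction n generalizing x with
  | zero => exact ⟨Fin.elim0, x, rfl⟩
  | succ n ih =>
    obtain ⟨i, y, rfl⟩ := exists_F_eq x
    obtain ⟨ω, z, rfl⟩ := ih y
    exact ⟨Fin.cons i ω, z, wordMap_cons i ω z⟩

/-- The distance of two points of `K` is at most the diameter of `K`. -/
theorem dist_le_diam (x y : K) : dist x y ≤ Metric.diam (Set.univ : Set K) :=
  Metric.dist_le_diam_of_mem isCompact_univ.isBounded trivial trivial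

theorem tendsto_half_pow_mul (C : ℝ) : Tendsto (fun n : ℕ => (1 / 2 : ℝ) ^ n * C) atTop (𝓝 0) := by
  simpa using (tendsto_pow_atTop_nhds_zero_of_lt_one (by norm_num : (0 : ℝ) ≤ 1 / 2)
    (by norm_num)).mul_const C

theorem exists_dist_wordMap_lt {ε : ℝ} (hε : 0 < ε) :
    ∃ N, ∀ n ≥ N, ∀ (ω : Fin n → Fin 3) (x y : K), dist (wordMap n ω x) (wordMap n ω y) < ε := by
  obtain ⟨N, hN⟩ := eventually_atTop.1
    ((tendsto_half_pow_mul (Metric.diam (Set.univ : Set K))).eventually_lt_const hε)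
  refine ⟨N, fun n hn ω x y => lt_of_le_of_lt ?_ (hN n hn)⟩
  rw [dist_wordMap]
  gcongr
  exact dist_le_diam x y

/-! ### The recursion on the resistances -/

namespace IsRecursive

variable {x y z : ℕ → ℝ}

theorem shift (h : IsRecursive x y z) (m : ℕ) :
    IsRecursive (fun n => x (m + n)) (fun n => y (m + n)) (fun n => z (m + n)) :=
  ⟨fun _ => h.x_pos _, fun _ => h.y_pos _, fun _ => h.z_pos _,
    fun _ => h.x_eq _, fun _ => h.y_eq _, fun _ => h.z_eq _⟩

/-- From level `n + 1` back to level `n` the difference `y - z` is multiplied by a positive factor,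
so its vanishing propagates to finer levels. -/
theorem y_eq_z (h : IsRecursive x y z) (h0 : y 0 = z 0) (n : ℕ) : y n = z n := by
  induction n with
  | zero => exact h0
  | succ n ih =>
    rw [h.y_eq n, h.z_eq n] at ih
    have hx := h.x_pos (n + 1)
    have hy := h.y_pos (n + 1)
    have hz := h.z_pos (n + 1)
    generalize x (n + 1) = X at *
    generalize y (n + 1) = Y at *
    generalize z (n + 1) = Z at *
    have e : (Y + φ Y Z X) - (Z + φ Z X Y) =
        (Y - Z) * (1 + (Y + Z) / (2 * (X + Y + Z))) := by
      have h1 : X + Y + Z ≠ 0 := by positivity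
      have h2 : Y + Z + X ≠ 0 := by positivity
      have h3 : Z + X + Y ≠ 0 := by positivity
      unfold φ
      field_simp
      ring
    rw [ih, sub_self, eq_comm, mul_eq_zero] at e
    rcases e with e | e
    · linarith
    · have : 0 < 1 + (Y + Z) / (2 * (X + Y + Z)) := by positivity
      linarith

theorem x_eq' (h : IsRecursive x y z) (h0 : y 0 = z 0) (n : ℕ) :
    x n = x (n + 1) + (x (n + 1) + y (n + 1)) ^ 2 / (2 * (x (n + 1) + 2 * y (n + 1))) := by
  rw [h.x_eq n, ← h.y_eq_z h0 (n + 1)]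
  unfold φ
  ring_nf

theorem y_eq' (h : IsRecursive x y z) (h0 : y 0 = z 0) (n : ℕ) :
    y n = y (n + 1) + y (n + 1) * (x (n + 1) + y (n + 1)) / (x (n + 1) + 2 * y (n + 1)) := by
  have hx := h.x_pos (n + 1)
  have hy := h.y_pos (n + 1)
  rw [h.y_eq n, ← h.y_eq_z h0 (n + 1)]
  generalize x (n + 1) = X at *
  generalize y (n + 1) = Y at *
  unfold φ
  have h1 : Y + Y + X ≠ 0 := by positivity
  have h2 : X + 2 * Y ≠ 0 := by positivity
  field_simp
  ring

/-- The excess `x / y - 1` of the ratio of the resistances grows by the factor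
`(4 x + 6 y) / (3 x + 5 y)`. -/
theorem excess_eq (h : IsRecursive x y z) (h0 : y 0 = z 0) (n : ℕ) :
    (x n - y n) * y (n + 1) * (4 * x (n + 1) + 6 * y (n + 1)) =
      (x (n + 1) - y (n + 1)) * y n * (3 * x (n + 1) + 5 * y (n + 1)) := by
  have hx := h.x_pos (n + 1)
  have hy := h.y_pos (n + 1)
  rw [h.x_eq' h0 n, h.y_eq' h0 n]
  generalize x (n + 1) = X at *
  generalize y (n + 1) = Y at *
  have h2 : X + 2 * Y ≠ 0 := by positivity
  field_simp
  ring

/-- By `excess_eq` the sign of `x - y` is the same at consecutive levels. -/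
theorem y_lt_x (h : IsRecursive x y z) (h0 : y 0 = z 0) (h1 : y 0 < x 0) (n : ℕ) : y n < x n := by
  induction n with
  | zero => exact h1
  | succ n ih =>
    have e := h.excess_eq h0 n
    have hx := h.x_pos (n + 1)
    have hy := h.y_pos (n + 1)
    have hy' := h.y_pos n
    have : 0 < (x (n + 1) - y (n + 1)) * (y n * (3 * x (n + 1) + 5 * y (n + 1))) := by
      rw [← mul_assoc, ← e]
      have := sub_pos.2 ih
      positivity
    exact sub_pos.1 ((pos_iff_pos_of_mul_pos this).2 (by positivity))

end IsRecursive

/-- Backward step of the recursion. -/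
theorem exists_recursion_step {X Y : ℝ} (hY : 0 < Y) (hXY : Y < X) :
    ∃ x y : ℝ, 0 < y ∧ y < x ∧ X = x + (x + y) ^ 2 / (2 * (x + 2 * y)) ∧
      Y = y + y * (x + y) / (x + 2 * y) := by
  set T := X / Y with hT
  have hT1 : 1 < T := (one_lt_div hY).2 hXY
  have hX : X = T * Y := by rw [hT]; field_simp
  set R := √(4 * T ^ 2 + 6 * T + 6) with hR
  have hR2 : R ^ 2 = 4 * T ^ 2 + 6 * T + 6 := Real.sq_sqrt (by positivity)
  have hRT : 2 * T < R := by
    apply Real.lt_sqrt_of_sq_lt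
    nlinarith
  -- The ratio `t` of the finer resistances must satisfy `3t² + 6t + 1 = T (4t + 6)`; this is the
  -- larger root of that quadratic.
  set t := (2 * T - 3 + R) / 3 with ht
  have ht1 : 1 < t := by
    have : 6 - 2 * T < R := by
      apply Real.lt_sqrt_of_sq_lt
      nlinarith
    rw [ht]
    linarith
  have hq : 3 * t ^ 2 + 6 * t + 1 = T * (4 * t + 6) := by
    have : R = 3 * t - 2 * T + 3 := by rw [ht]; ring
    rw [this] at hR2
    linarith
  have h1 : 0 < t + 2 := by linarith
  have h2 : 0 < 2 * t + 3 := by linarith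
  have hy : 0 < Y * (t + 2) / (2 * t + 3) := by positivity
  refine ⟨t * (Y * (t + 2) / (2 * t + 3)), Y * (t + 2) / (2 * t + 3), hy,
    by nlinarith, ?_, ?_⟩
  · rw [hX]
    have : T = (3 * t ^ 2 + 6 * t + 1) / (4 * t + 6) := by
      rw [hq]; field_simp
    rw [this]
    field_simp
    ring
  · field_simp
    ring

/-- The old ratio is `(3t² + 6t + 1) / (4t + 6)` in terms of the new ratio `t`. Equating two such
values leaves `t - t'` times a positive factor, so the ratio is determined, and then homogeneity
determines the scale. -/
theorem recursion_step_injective {x y x' y' : ℝ} (hy : 0 < y) (hx : y < x) (hy' : 0 < y')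
    (hx' : y' < x')
    (h1 : x + (x + y) ^ 2 / (2 * (x + 2 * y)) = x' + (x' + y') ^ 2 / (2 * (x' + 2 * y')))
    (h2 : y + y * (x + y) / (x + 2 * y) = y' + y' * (x' + y') / (x' + 2 * y')) :
    x = x' ∧ y = y' := by
  set t := x / y with ht
  set t' := x' / y' with ht'
  have ht1 : 1 < t := (one_lt_div hy).2 hx
  have ht1' : 1 < t' := (one_lt_div hy').2 hx'
  have ex : x = t * y := by rw [ht]; field_simp
  have ex' : x' = t' * y' := by rw [ht']; field_simp
  rw [ex, ex'] at h1 h2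
  have e1 : ∀ t y : ℝ, 0 < y → 1 < t → t * y + (t * y + y) ^ 2 / (2 * (t * y + 2 * y)) =
      y * ((3 * t ^ 2 + 6 * t + 1) / (2 * (t + 2))) := by
    intro t y hy ht
    have : t + 2 ≠ 0 := by positivity
    have : t * y + 2 * y ≠ 0 := by positivity
    field_simp
    ring
  have e2 : ∀ t y : ℝ, 0 < y → 1 < t → y + y * (t * y + y) / (t * y + 2 * y) =
      y * ((2 * t + 3) / (t + 2)) := by
    intro t y hy ht
    have : t + 2 ≠ 0 := by positivity
    have : t * y + 2 * y ≠ 0 := by positivity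
    field_simp
    ring
  rw [e1 t y hy ht1, e1 t' y' hy' ht1'] at h1
  rw [e2 t y hy ht1, e2 t' y' hy' ht1'] at h2
  have p1 : (0 : ℝ) < t + 2 := by linarith
  have p1' : (0 : ℝ) < t' + 2 := by linarith
  have h3 : (3 * t ^ 2 + 6 * t + 1) * (2 * t' + 3) = (3 * t' ^ 2 + 6 * t' + 1) * (2 * t + 3) := by
    have h4 : (y * ((3 * t ^ 2 + 6 * t + 1) / (2 * (t + 2)))) * (y' * ((2 * t' + 3) / (t' + 2))) =
        (y' * ((3 * t' ^ 2 + 6 * t' + 1) / (2 * (t' + 2)))) * (y * ((2 * t + 3) / (t + 2))) := by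
      rw [h1, h2]
    field_simp at h4
    linarith
  have h5 : t = t' := by
    have : (t - t') * (6 * t * t' + 9 * (t + t') + 16) = 0 := by linear_combination h3
    rcases mul_eq_zero.1 this with h | h
    · linarith
    · have : 0 < 6 * t * t' + 9 * (t + t') + 16 := by positivity
      linarith
  have h6 : y = y' := by
    rw [h5] at h2
    refine mul_right_cancel₀ ?_ h2
    have : 0 < (2 * t' + 3) / (t' + 2) := by positivity
    exact this.ne'
  exact ⟨by rw [ex, ex', h5, h6], h6⟩

theorem IsRecursive.unique {x y z x' y' z' : ℕ → ℝ} (h : IsRecursive x y z) (h0 : y 0 = z 0)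
    (h1 : y 0 < x 0) (h' : IsRecursive x' y' z') (hx : x' 0 = x 0) (hy : y' 0 = y 0)
    (hz : z' 0 = z 0) (n : ℕ) : x' n = x n ∧ y' n = y n ∧ z' n = z n := by
  have h0' : y' 0 = z' 0 := by rw [hy, hz, h0]
  have h1' : y' 0 < x' 0 := by rw [hx, hy]; exact h1
  have key : ∀ n, x' n = x n ∧ y' n = y n := by
    intro n
    induction n with
    | zero => exact ⟨hx, hy⟩
    | succ n ih =>
      rw [h.x_eq' h0 n, h.y_eq' h0 n, h'.x_eq' h0' n, h'.y_eq' h0' n] at ih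
      exact recursion_step_injective (h'.y_pos _) (h'.y_lt_x h0' h1' _) (h.y_pos _)
        (h.y_lt_x h0 h1 _) ih.1 ih.2
  exact ⟨(key n).1, (key n).2, by rw [← h.y_eq_z h0, ← h'.y_eq_z h0', (key n).2]⟩

theorem existsUnique_isRecursive {x₀ y₀ : ℝ} (hy : 0 < y₀) (hx : y₀ < x₀) :
    ∃! s : ℕ → ℝ × ℝ × ℝ,
      IsRecursive (fun n => (s n).1) (fun n => (s n).2.1) (fun n => (s n).2.2) ∧
        s 0 = (x₀, y₀, y₀) := by
  have step : ∀ q : {q : ℝ × ℝ // 0 < q.2 ∧ q.2 < q.1}, ∃ q' : {q : ℝ × ℝ // 0 < q.2 ∧ q.2 < q.1},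
      q.1.1 = q'.1.1 + (q'.1.1 + q'.1.2) ^ 2 / (2 * (q'.1.1 + 2 * q'.1.2)) ∧
      q.1.2 = q'.1.2 + q'.1.2 * (q'.1.1 + q'.1.2) / (q'.1.1 + 2 * q'.1.2) := by
    rintro ⟨⟨X, Y⟩, hY, hXY⟩
    obtain ⟨x, y, h1, h2, h3, h4⟩ := exists_recursion_step hY hXY
    exact ⟨⟨(x, y), h1, h2⟩, h3, h4⟩
  choose S hS using step
  let q : ℕ → {q : ℝ × ℝ // 0 < q.2 ∧ q.2 < q.1} := fun n => S^[n] ⟨(x₀, y₀), hy, hx⟩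
  have hq : ∀ n, q (n + 1) = S (q n) := fun n => Function.iterate_succ_apply' _ _ _
  have hpos : ∀ n, 0 < (q n).1.2 := fun n => (q n).2.1
  have hpos' : ∀ n, 0 < (q n).1.1 := fun n => (q n).2.1.trans (q n).2.2
  have hyz : ∀ n, (q n).1.2 = (q (n + 1)).1.2 +
      φ (q (n + 1)).1.2 (q (n + 1)).1.2 (q (n + 1)).1.1 := by
    intro n
    rw [(hS (q n)).2, ← hq]
    have h1 := hpos (n + 1)
    have h2 := hpos' (n + 1)
    generalize (q (n + 1)).1.1 = X at *
    generalize (q (n + 1)).1.2 = Y at *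
    have h3 : Y + Y + X ≠ 0 := by positivity
    have h4 : X + 2 * Y ≠ 0 := by positivity
    unfold φ
    field_simp
    ring
  have hr : IsRecursive (fun n => (q n).1.1) (fun n => (q n).1.2) (fun n => (q n).1.2) := by
    refine ⟨hpos', hpos, hpos, fun n => ?_, hyz, fun n => ?_⟩
    · show (q n).1.1 = _
      rw [(hS (q n)).1, ← hq]
      unfold φ
      ring_nf
    · show (q n).1.2 = _
      rw [hyz n]
      unfold φ
      ring_nf
  refine ⟨fun n => ((q n).1.1, (q n).1.2, (q n).1.2), ⟨hr, rfl⟩, ?_⟩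
  rintro s ⟨hs, hs0⟩
  funext n
  have := hr.unique rfl hx hs (by simp [hs0, q]) (by simp [hs0, q]) (by simp [hs0, q]) n
  exact Prod.ext this.1 (Prod.ext this.2.1 this.2.2)

/-! ### Growth of the conductances -/

/-- Conductances `(aₙ, bₙ, bₙ)` of a compatible sequence of networks, with `aₙ ≍ 2ⁿ` and
`bₙ ≍ (3/2)ⁿ`. -/
structure IsNetwork (a b : ℕ → ℝ) : Prop where
  b_pos : ∀ n, 0 < b n
  b_le_a : ∀ n, b n ≤ a n
  b_eq : ∀ n, b n = b (n + 1) * (2 * a (n + 1) + b (n + 1)) / (3 * a (n + 1) + 2 * b (n + 1))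
  a_eq : ∀ n, 2 * a n + b n =
    a (n + 1) + b (n + 1) - b (n + 1) ^ 2 / (2 * a (n + 1) + 3 * b (n + 1))
  a_comparable : Comparable a fun n => 2 ^ n
  b_comparable : Comparable b fun n => (3 / 2) ^ n

theorem IsNetwork.a_pos {a b : ℕ → ℝ} (h : IsNetwork a b) (n : ℕ) : 0 < a n :=
  (h.b_pos n).trans_le (h.b_le_a n)

theorem Comparable.shift {f : ℕ → ℝ} {q : ℝ} (hq : 0 < q) (h : Comparable f fun n => q ^ n)
    (m : ℕ) : Comparable (fun n => f (m + n)) fun n => q ^ n := by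
  obtain ⟨C, hC, h⟩ := h
  have hm : 0 < q ^ m := by positivity
  -- The two inequalities need the constants `C * q ^ m` and `C / q ^ m`; their sum serves for both.
  refine ⟨C * q ^ m + C / q ^ m, by positivity, fun n => ⟨?_, ?_⟩⟩
  · calc f (m + n) ≤ C * q ^ (m + n) := (h _).1
      _ = C * q ^ m * q ^ n := by ring
      _ ≤ _ := by
        gcongr
        exact le_add_of_nonneg_right (by positivity)
  · have h2 := (h (m + n)).2
    have hf : 0 ≤ f (m + n) := by
      have : 0 < C * f (m + n) := lt_of_lt_of_le (by positivity) h2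
      exact (pos_of_mul_pos_right this hC.le).le
    calc q ^ n = q ^ (m + n) / q ^ m := by rw [pow_add]; field_simp
      _ ≤ C * f (m + n) / q ^ m := by gcongr
      _ = C / q ^ m * f (m + n) := by ring
      _ ≤ _ := by
        gcongr
        exact le_add_of_nonneg_left (by positivity)

theorem IsNetwork.shift {a b : ℕ → ℝ} (h : IsNetwork a b) (m : ℕ) :
    IsNetwork (fun n => a (m + n)) (fun n => b (m + n)) :=
  ⟨fun _ => h.b_pos _, fun _ => h.b_le_a _, fun _ => h.b_eq _, fun _ => h.a_eq _,
    h.a_comparable.shift (by norm_num) m, h.b_comparable.shift (by norm_num) m⟩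

namespace IsRecursive

variable {x y z : ℕ → ℝ}

theorem conductance_a (h : IsRecursive x y z) (h0 : y 0 = z 0) (n : ℕ) :
    conductance (x n) (y n) (z n) = x n / (y n * (2 * x n + y n)) := by
  rw [← h.y_eq_z h0 n, conductance]
  congr 1
  ring

theorem conductance_b (h : IsRecursive x y z) (h0 : y 0 = z 0) (n : ℕ) :
    conductance (y n) (z n) (x n) = 1 / (2 * x n + y n) := by
  have hx := h.x_pos n
  have hy := h.y_pos n
  rw [← h.y_eq_z h0 n, conductance]
  field_simp
  ring

theorem conductance_c (h : IsRecursive x y z) (h0 : y 0 = z 0) (n : ℕ) :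
    conductance (z n) (x n) (y n) = 1 / (2 * x n + y n) := by
  have hx := h.x_pos n
  have hy := h.y_pos n
  rw [← h.y_eq_z h0 n, conductance]
  field_simp
  ring

/-- The excess `x / y - 1` grows at least geometrically. -/
theorem excess_growth (h : IsRecursive x y z) (h0 : y 0 = z 0) (h1 : y 0 < x 0) (n : ℕ) :
    x n / y n - 1 ≤ 4 / 5 * (x (n + 1) / y (n + 1) - 1) := by
  have e := h.excess_eq h0 n
  have hy := h.y_pos n
  have hy' := h.y_pos (n + 1)
  have hx' := h.y_lt_x h0 h1 (n + 1)
  have hx := h.y_lt_x h0 h1 n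
  have e1 : x n / y n - 1 = (x n - y n) / y n := by field_simp
  have e2 : x (n + 1) / y (n + 1) - 1 = (x (n + 1) - y (n + 1)) / y (n + 1) := by field_simp
  have e3 : (x n - y n) / y n = (x (n + 1) - y (n + 1)) / y (n + 1) *
      ((3 * x (n + 1) + 5 * y (n + 1)) / (4 * x (n + 1) + 6 * y (n + 1))) := by
    have : 0 < 4 * x (n + 1) + 6 * y (n + 1) := by linarith
    rw [div_mul_div_comm, div_eq_div_iff hy.ne' (by positivity)]
    linarith
  have e4 : (3 * x (n + 1) + 5 * y (n + 1)) / (4 * x (n + 1) + 6 * y (n + 1)) ≤ 4 / 5 := by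
    rw [div_le_div_iff₀ (by linarith) (by norm_num)]
    linarith
  rw [e1, e2, e3, mul_comm (4 / 5 : ℝ)]
  have : 0 < x (n + 1) - y (n + 1) := sub_pos.2 hx'
  gcongr

theorem excess_pos (h : IsRecursive x y z) (h0 : y 0 = z 0) (h1 : y 0 < x 0) (n : ℕ) :
    0 < x n / y n - 1 :=
  sub_pos.2 ((one_lt_div (h.y_pos n)).2 (h.y_lt_x h0 h1 n))

/-- `2 ^ n * y n` is nondecreasing. Multiplied by the correction `1 + 2 / s`, where `s` is the
excess, it becomes nonincreasing, since the growth of `s` by `5/4` outweighs the error of one step.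
As the correction is at least `1`, this bounds `2 ^ n * y n` on both sides without an infinite
product. -/
theorem y_bounds (h : IsRecursive x y z) (h0 : y 0 = z 0) (h1 : y 0 < x 0) (n : ℕ) :
    y 0 ≤ 2 ^ n * y n ∧
      2 ^ n * y n * (1 + 2 / (x n / y n - 1)) ≤ y 0 * (1 + 2 / (x 0 / y 0 - 1)) := by
  induction n with
  | zero => simp
  | succ n ih =>
    have hs := h.excess_growth h0 h1 n
    have hp := h.excess_pos h0 h1 n
    have hp' := h.excess_pos h0 h1 (n + 1)
    have hy := h.y_pos n
    have hy' := h.y_pos (n + 1)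
    have e : y n = y (n + 1) * ((2 * (x (n + 1) / y (n + 1) - 1) + 5) /
        (x (n + 1) / y (n + 1) - 1 + 3)) := by
      have hx' := h.x_pos (n + 1)
      rw [h.y_eq' h0 n]
      generalize x (n + 1) = X at *
      generalize y (n + 1) = Y at *
      have : X + 2 * Y ≠ 0 := by positivity
      have : X / Y - 1 + 3 ≠ 0 := by positivity
      have e : X / Y - 1 + 3 = (X + 2 * Y) / Y := by field_simp; ring
      have e' : 2 * (X / Y - 1) + 5 = (2 * X + 3 * Y) / Y := by field_simp; ring
      rw [e, e']
      field_simp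
      ring
    generalize x (n + 1) / y (n + 1) - 1 = S at *
    generalize x n / y n - 1 = s at *
    constructor
    · refine ih.1.trans ?_
      have : (2 * S + 5) / (S + 3) ≤ 2 := by
        rw [div_le_iff₀ (by positivity)]
        linarith
      rw [e]
      calc 2 ^ n * (y (n + 1) * ((2 * S + 5) / (S + 3))) ≤ 2 ^ n * (y (n + 1) * 2) := by gcongr
        _ = _ := by ring
    · refine le_trans ?_ ih.2
      have : 2 / S * (5 / 4) ≤ 2 / s := by
        rw [div_mul_eq_mul_div, div_le_div_iff₀ hp' hp]
        linarith
      calc 2 ^ (n + 1) * y (n + 1) * (1 + 2 / S) = 2 ^ n * y (n + 1) * (2 * (1 + 2 / S)) := by ring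
        _ ≤ 2 ^ n * y (n + 1) * ((2 * S + 5) / (S + 3) * (1 + 2 / S * (5 / 4))) := by
          refine mul_le_mul_of_nonneg_left ?_ (by positivity)
          rw [← sub_nonneg]
          have : (2 * S + 5) / (S + 3) * (1 + 2 / S * (5 / 4)) - 2 * (1 + 2 / S) =
              1 / (2 * S * (S + 3)) := by field_simp; ring
          rw [this]
          positivity
        _ = 2 ^ n * (y (n + 1) * ((2 * S + 5) / (S + 3))) * (1 + 2 / S * (5 / 4)) := by ring
        _ ≤ _ := by
          rw [← e]
          gcongr

/-- The counterpart of `y_bounds` with reversed monotonicity: `(3/2) ^ n * x n` is nonincreasing,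
and dividing by `1 + 1 / s` makes it nondecreasing. -/
theorem x_bounds (h : IsRecursive x y z) (h0 : y 0 = z 0) (h1 : y 0 < x 0) (n : ℕ) :
    (3 / 2) ^ n * x n ≤ x 0 ∧
      x 0 / (1 + 1 / (x 0 / y 0 - 1)) ≤ (3 / 2) ^ n * x n / (1 + 1 / (x n / y n - 1)) := by
  induction n with
  | zero => simp
  | succ n ih =>
    have hs := h.excess_growth h0 h1 n
    have hp := h.excess_pos h0 h1 n
    have hp' := h.excess_pos h0 h1 (n + 1)
    have hx := h.x_pos n
    have hx' := h.x_pos (n + 1)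
    have e : x n = x (n + 1) * ((3 / 2) * (1 + 1 / (3 * (x (n + 1) / y (n + 1) - 1 + 1) *
        (x (n + 1) / y (n + 1) - 1 + 3)))) := by
      have hy' := h.y_pos (n + 1)
      rw [h.x_eq' h0 n]
      generalize x (n + 1) = X at *
      generalize y (n + 1) = Y at *
      have e : X / Y - 1 + 3 = (X + 2 * Y) / Y := by field_simp; ring
      have e' : X / Y - 1 + 1 = X / Y := by ring
      rw [e, e']
      field_simp
      ring
    generalize x (n + 1) / y (n + 1) - 1 = S at *
    generalize x n / y n - 1 = s at *
    constructor
    · refine le_trans ?_ ih.1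
      have : 0 ≤ 1 / (3 * (S + 1) * (S + 3)) := by positivity
      rw [e]
      calc (3 / 2) ^ (n + 1) * x (n + 1) = (3 / 2) ^ n * (x (n + 1) * (3 / 2 * 1)) := by ring
        _ ≤ _ := by gcongr; linarith
    · refine ih.2.trans ?_
      have : 1 / S * (5 / 4) ≤ 1 / s := by
        rw [div_mul_eq_mul_div, div_le_div_iff₀ hp' hp]
        linarith
      calc (3 / 2) ^ n * x n / (1 + 1 / s) ≤ (3 / 2) ^ n * x n / (1 + 1 / S * (5 / 4)) := by gcongr
        _ = (3 / 2) ^ (n + 1) * x (n + 1) * ((1 + 1 / (3 * (S + 1) * (S + 3))) /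
            (1 + 1 / S * (5 / 4))) := by rw [e]; ring
        _ ≤ (3 / 2) ^ (n + 1) * x (n + 1) * (1 / (1 + 1 / S)) := by
          refine mul_le_mul_of_nonneg_left ?_ (by positivity)
          rw [div_le_div_iff₀ (by positivity) (by positivity), ← sub_nonneg]
          have : 1 * (1 + 1 / S * (5 / 4)) - (1 + 1 / (3 * (S + 1) * (S + 3))) * (1 + 1 / S) =
              (3 * S + 5) / (12 * S * (S + 3)) := by field_simp; ring
          rw [this]
          positivity
        _ = _ := by ring

/-- The two compatibility relations are those for `x` and `y` in other variables, because `1 / b =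
2x + y` and `2a + b = 1 / y`. -/
theorem isNetwork (h : IsRecursive x y z) (h0 : y 0 = z 0) (h1 : y 0 < x 0) :
    IsNetwork (fun n => x n / (y n * (2 * x n + y n))) (fun n => 1 / (2 * x n + y n)) := by
  have hx := h.x_pos
  have hy := h.y_pos
  have hxy := h.y_lt_x h0 h1
  have hs0 := h.excess_pos h0 h1 0
  have hx0 := hx 0
  have hy0 := hy 0
  refine ⟨fun n => ?_, fun n => ?_, fun n => ?_, fun n => ?_, ?_, ?_⟩
  · have := hx n; have := hy n; positivity
  · have := hx n
    have := hy n
    rw [div_le_div_iff₀ (by positivity) (by positivity)]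
    nlinarith [hxy n]
  · have hX := hx (n + 1)
    have hY := hy (n + 1)
    show 1 / (2 * x n + y n) = _
    rw [h.x_eq' h0 n, h.y_eq' h0 n]
    generalize x (n + 1) = X at *
    generalize y (n + 1) = Y at *
    have : 3 * X + 2 * Y ≠ 0 := by positivity
    field_simp
    ring
  · have hX := hx (n + 1)
    have hY := hy (n + 1)
    have hX' := hx n
    have hY' := hy n
    have e : 2 * (x n / (y n * (2 * x n + y n))) + 1 / (2 * x n + y n) = 1 / y n := by
      field_simp
    show 2 * (x n / (y n * (2 * x n + y n))) + 1 / (2 * x n + y n) = _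
    rw [e, h.y_eq' h0 n]
    generalize x (n + 1) = X at *
    generalize y (n + 1) = Y at *
    have : 2 * X + 3 * Y ≠ 0 := by positivity
    field_simp
    ring
  · have hb := h.y_bounds h0 h1
    have hC : 0 < y 0 * (1 + 2 / (x 0 / y 0 - 1)) := by positivity
    generalize y 0 * (1 + 2 / (x 0 / y 0 - 1)) = C at *
    refine ⟨1 / y 0 + 3 * C, by positivity, fun n => ?_⟩
    have hX := hx n
    have hY := hy n
    have hXY := hxy n
    have hb1 := (hb n).1
    have hb2 : 2 ^ n * y n ≤ C := by
      refine le_trans ?_ (hb n).2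
      have := h.excess_pos h0 h1 n
      exact le_mul_of_one_le_right (by positivity) (le_add_of_nonneg_right (by positivity))
    constructor
    · calc x n / (y n * (2 * x n + y n)) ≤ 1 / y n := by
            rw [div_le_div_iff₀ (by positivity) hY]
            nlinarith
        _ ≤ 1 / y 0 * 2 ^ n := by
            rw [div_mul_eq_mul_div, div_le_div_iff₀ hY hy0]
            linarith
        _ ≤ _ := by
            gcongr
            linarith
    · calc (2 : ℝ) ^ n ≤ C / y n := by rw [le_div_iff₀ hY]; exact hb2
        _ ≤ 3 * C * (x n / (y n * (2 * x n + y n))) := by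
            rw [← mul_div_assoc, div_le_div_iff₀ hY (by positivity)]
            have : C * (y n * (2 * x n + y n)) ≤ C * (y n * (3 * x n)) := by
              gcongr; linarith
            linarith
        _ ≤ _ := by
            gcongr
            have : 0 < 1 / y 0 := by positivity
            linarith
  · have hb := h.x_bounds h0 h1
    have hC : 0 < x 0 / (1 + 1 / (x 0 / y 0 - 1)) := by positivity
    generalize x 0 / (1 + 1 / (x 0 / y 0 - 1)) = C at *
    refine ⟨1 / C + 3 * x 0, by positivity, fun n => ?_⟩
    have hX := hx n
    have hY := hy n
    have hXY := hxy n
    have hb1 := (hb n).1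
    have hb2 : C ≤ (3 / 2) ^ n * x n := by
      refine (hb n).2.trans (div_le_self (by positivity) ?_)
      have := h.excess_pos h0 h1 n
      exact le_add_of_nonneg_right (by positivity)
    constructor
    · calc 1 / (2 * x n + y n) ≤ 1 / x n := by gcongr; linarith
        _ ≤ 1 / C * (3 / 2) ^ n := by
            rw [div_mul_eq_mul_div, div_le_div_iff₀ hX hC]
            linarith
        _ ≤ _ := by gcongr; linarith
    · calc ((3 : ℝ) / 2) ^ n ≤ x 0 / x n := by rw [le_div_iff₀ hX]; exact hb1
        _ ≤ 3 * x 0 * (1 / (2 * x n + y n)) := by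
            rw [mul_one_div, div_le_div_iff₀ hX (by positivity)]
            nlinarith
        _ ≤ _ := by
            gcongr
            have : 0 < 1 / C := by positivity
            linarith

end IsRecursive

/-! ### Graph energies -/

theorem sum_words_succ {M : Type*} [AddCommMonoid M] {n : ℕ} (f : (Fin (n + 1) → Fin 3) → M) :
    ∑ ω, f ω = ∑ i : Fin 3, ∑ ω : Fin n → Fin 3, f (Fin.cons i ω) := by
  rw [← Fintype.sum_prod_type' (f := fun i (ω : Fin n → Fin 3) => f (Fin.cons i ω))]
  exact (Equiv.sum_comp (Fin.consEquiv fun _ => Fin 3) f).symm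

theorem graphEnergy_zero (a b c : ℝ) (u : C(K, ℝ)) :
    graphEnergy a b c 0 u = a * (u (vertex 1) - u (vertex 2)) ^ 2 +
      b * (u (vertex 0) - u (vertex 2)) ^ 2 + c * (u (vertex 0) - u (vertex 1)) ^ 2 := by
  simp [graphEnergy, wordMap]

theorem graphEnergy_succ (a b c : ℝ) (n : ℕ) (u : C(K, ℝ)) :
    graphEnergy a b c (n + 1) u = ∑ i, graphEnergy a b c n (u.comp (F i)) := by
  simp only [graphEnergy, sum_words_succ, wordMap_cons, ContinuousMap.comp_apply]

theorem graphEnergy_nonneg {a b c : ℝ} (ha : 0 ≤ a) (hb : 0 ≤ b) (hc : 0 ≤ c) (n : ℕ)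
    (u : C(K, ℝ)) : 0 ≤ graphEnergy a b c n u :=
  Finset.sum_nonneg fun _ _ => by positivity

theorem graphEnergy_mono_coeff {a b c a' b' c' : ℝ} (ha : a ≤ a') (hb : b ≤ b') (hc : c ≤ c')
    (n : ℕ) (u : C(K, ℝ)) : graphEnergy a b c n u ≤ graphEnergy a' b' c' n u :=
  Finset.sum_le_sum fun _ _ => by gcongr

theorem graphEnergy_mul_coeff (t a b c : ℝ) (n : ℕ) (u : C(K, ℝ)) :
    graphEnergy (t * a) (t * b) (t * c) n u = t * graphEnergy a b c n u := by
  rw [graphEnergy, graphEnergy, Finset.mul_sum]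
  exact Finset.sum_congr rfl fun _ _ => by ring

/-- The graph energy decreases if all differences decrease, as under a normal contraction. -/
theorem graphEnergy_le_of_abs_sub_le {a b c : ℝ} (ha : 0 ≤ a) (hb : 0 ≤ b) (hc : 0 ≤ c) (n : ℕ)
    {u v : C(K, ℝ)} (h : ∀ x y, |u x - u y| ≤ |v x - v y|) :
    graphEnergy a b c n u ≤ graphEnergy a b c n v :=
  Finset.sum_le_sum fun ω _ => by
    have h' := fun x y => sq_le_sq.2 (h x y)
    gcongr a * ?_ + b * ?_ + c * ?_ <;> exact h' _ _

theorem graphEnergy_smul (a b c t : ℝ) (n : ℕ) (u : C(K, ℝ)) :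
    graphEnergy a b c n (t • u) = t ^ 2 * graphEnergy a b c n u := by
  rw [graphEnergy, graphEnergy, Finset.mul_sum]
  refine Finset.sum_congr rfl fun _ _ => ?_
  simp only [ContinuousMap.smul_apply, smul_eq_mul]
  ring

theorem graphEnergy_const (a b c t : ℝ) (n : ℕ) :
    graphEnergy a b c n (ContinuousMap.const K t) = 0 := by
  simp [graphEnergy]

/-- The bilinear form of a graph energy. -/
noncomputable def graphForm (a b c : ℝ) (n : ℕ) (u v : C(K, ℝ)) : ℝ :=
  ∑ ω : Fin n → Fin 3,
    (a * ((u (wordMap n ω (vertex 1)) - u (wordMap n ω (vertex 2))) *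
        (v (wordMap n ω (vertex 1)) - v (wordMap n ω (vertex 2)))) +
      b * ((u (wordMap n ω (vertex 0)) - u (wordMap n ω (vertex 2))) *
        (v (wordMap n ω (vertex 0)) - v (wordMap n ω (vertex 2)))) +
      c * ((u (wordMap n ω (vertex 0)) - u (wordMap n ω (vertex 1))) *
        (v (wordMap n ω (vertex 0)) - v (wordMap n ω (vertex 1)))))

theorem graphForm_self (a b c : ℝ) (n : ℕ) (u : C(K, ℝ)) :
    graphForm a b c n u u = graphEnergy a b c n u :=
  Finset.sum_congr rfl fun _ _ => by ring

theorem graphForm_comm (a b c : ℝ) (n : ℕ) (u v : C(K, ℝ)) :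
    graphForm a b c n u v = graphForm a b c n v u :=
  Finset.sum_congr rfl fun _ _ => by ring

theorem graphForm_add_left (a b c : ℝ) (n : ℕ) (u v w : C(K, ℝ)) :
    graphForm a b c n (u + v) w = graphForm a b c n u w + graphForm a b c n v w := by
  rw [graphForm, graphForm, graphForm, ← Finset.sum_add_distrib]
  refine Finset.sum_congr rfl fun _ _ => ?_
  simp only [ContinuousMap.add_apply]
  ring

theorem graphForm_smul_left (a b c t : ℝ) (n : ℕ) (u w : C(K, ℝ)) :
    graphForm a b c n (t • u) w = t * graphForm a b c n u w := by
  rw [graphForm, graphForm, Finset.mul_sum]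
  refine Finset.sum_congr rfl fun _ _ => ?_
  simp only [ContinuousMap.smul_apply, smul_eq_mul]
  ring

theorem graphEnergy_add (a b c : ℝ) (n : ℕ) (u v : C(K, ℝ)) :
    graphEnergy a b c n (u + v) =
      graphEnergy a b c n u + graphEnergy a b c n v + 2 * graphForm a b c n u v := by
  rw [← graphForm_self, graphForm_add_left, graphForm_comm _ _ _ _ u, graphForm_comm _ _ _ _ v,
    graphForm_add_left, graphForm_add_left, graphForm_self, graphForm_self,
    graphForm_comm _ _ _ _ v u]
  ring

theorem graphEnergy_sub (a b c : ℝ) (n : ℕ) (u v : C(K, ℝ)) :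
    graphEnergy a b c n (u - v) =
      graphEnergy a b c n u + graphEnergy a b c n v - 2 * graphForm a b c n u v := by
  rw [sub_eq_add_neg, ← neg_one_smul ℝ v, graphEnergy_add, graphEnergy_smul,
    graphForm_comm _ _ _ _ u, graphForm_smul_left, graphForm_comm _ _ _ _ v]
  ring

theorem graphEnergy_add_le {a b c : ℝ} (ha : 0 ≤ a) (hb : 0 ≤ b) (hc : 0 ≤ c) (n : ℕ)
    (u v : C(K, ℝ)) :
    graphEnergy a b c n (u + v) ≤ 2 * graphEnergy a b c n u + 2 * graphEnergy a b c n v := by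
  have h := graphEnergy_nonneg ha hb hc n (u - v)
  rw [graphEnergy_sub] at h
  rw [graphEnergy_add]
  linarith

/-! ### Compatibility -/

/-- The energy of a triangle is at most the energy of three glued triangles whose network is
compatible with it. -/
theorem triangle_energy_le {a b A B : ℝ} (ha : 0 < a) (hb : 0 < b)
    (hB : B = b * (2 * a + b) / (3 * a + 2 * b))
    (hA : 2 * A + B = a + b - b ^ 2 / (2 * a + 3 * b)) (α₀ α₁ α₂ β₀ β₁ β₂ : ℝ) :
    A * (α₁ - α₂) ^ 2 + B * (α₀ - α₂) ^ 2 + B * (α₀ - α₁) ^ 2 ≤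
      (a * (β₂ - β₁) ^ 2 + b * (α₀ - β₁) ^ 2 + b * (α₀ - β₂) ^ 2) +
      (a * (α₁ - β₀) ^ 2 + b * (β₂ - β₀) ^ 2 + b * (β₂ - α₁) ^ 2) +
      (a * (β₀ - α₂) ^ 2 + b * (β₁ - α₂) ^ 2 + b * (β₁ - β₀) ^ 2) := by
  have hA' : A = (a + b - b ^ 2 / (2 * a + 3 * b) - b * (2 * a + b) / (3 * a + 2 * b)) / 2 := by
    rw [← hA, ← hB]; ring
  have h1 : 2 * a + 3 * b ≠ 0 := by positivity
  have h2 : 3 * a + 2 * b ≠ 0 := by positivity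
  have h3 : a + b ≠ 0 := by positivity
  -- Squares are completed by symmetry: the antisymmetric part of `β₁, β₂` decouples, then `β₀` is
  -- eliminated, then the mean of `β₁, β₂`. All three squares vanish at the harmonic extension, so
  -- the remainder is the trace.
  have key : (a * (β₂ - β₁) ^ 2 + b * (α₀ - β₁) ^ 2 + b * (α₀ - β₂) ^ 2) +
      (a * (α₁ - β₀) ^ 2 + b * (β₂ - β₀) ^ 2 + b * (β₂ - α₁) ^ 2) +
      (a * (β₀ - α₂) ^ 2 + b * (β₁ - α₂) ^ 2 + b * (β₁ - β₀) ^ 2) -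
      (A * (α₁ - α₂) ^ 2 + B * (α₀ - α₂) ^ 2 + B * (α₀ - α₁) ^ 2) =
      (4 * a + 6 * b) * ((β₂ - β₁) / 2 - b * ((α₁ - α₂) / 2) / (2 * a + 3 * b)) ^ 2 +
      2 * (a + b) * (β₀ - (a * ((α₁ + α₂) / 2) + b * ((β₁ + β₂) / 2)) / (a + b)) ^ 2 +
      (4 * b + 2 * a * b / (a + b)) * ((β₁ + β₂) / 2 -
        ((a + b) * α₀ + (2 * a + b) * ((α₁ + α₂) / 2)) / (3 * a + 2 * b)) ^ 2 := by
    rw [hA', hB]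
    field_simp
    ring
  rw [← sub_nonneg, key]
  positivity

theorem graphEnergy_le_succ {a b A B : ℝ} (ha : 0 < a) (hb : 0 < b)
    (hB : B = b * (2 * a + b) / (3 * a + 2 * b))
    (hA : 2 * A + B = a + b - b ^ 2 / (2 * a + 3 * b)) (n : ℕ) (u : C(K, ℝ)) :
    graphEnergy A B B n u ≤ graphEnergy a b b (n + 1) u := by
  induction n generalizing u with
  | zero =>
    rw [graphEnergy_succ, graphEnergy_zero, Fin.sum_univ_three, graphEnergy_zero,
      graphEnergy_zero, graphEnergy_zero]
    simp only [ContinuousMap.comp_apply, F_vertex_self]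
    rw [F_vertex_comm 1 0, F_vertex_comm 2 0, F_vertex_comm 2 1]
    exact triangle_energy_le ha hb hB hA _ _ _ _ _ _
  | succ n ih =>
    rw [graphEnergy_succ, graphEnergy_succ a]
    exact Finset.sum_le_sum fun i _ => ih _

/-! ### The limit energy -/

/-- The supremum of the graph energies of the networks `(aₙ, bₙ, bₙ)`. -/
noncomputable def networkEnergy (a b : ℕ → ℝ) (u : C(K, ℝ)) : ℝ≥0∞ :=
  ⨆ n, ENNReal.ofReal (graphEnergy (a n) (b n) (b n) n u)

/-- The functions of finite energy, as a subspace of `C(K)` that does not depend on the network. -/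
def finiteEnergySubmodule : Submodule ℝ C(K, ℝ) where
  carrier := {u | ∃ C, ∀ n, graphEnergy (2 ^ n) ((3 / 2) ^ n) ((3 / 2) ^ n) n u ≤ C}
  zero_mem' := ⟨0, fun _ => (graphEnergy_const _ _ _ 0 _).le⟩
  add_mem' := by
    rintro u v ⟨C, hC⟩ ⟨D, hD⟩
    refine ⟨2 * C + 2 * D, fun n => ?_⟩
    have := graphEnergy_add_le (a := 2 ^ n) (b := (3 / 2) ^ n) (c := (3 / 2) ^ n) (by positivity)
      (by positivity) (by positivity) n u v
    linarith [hC n, hD n]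
  smul_mem' := by
    rintro t u ⟨C, hC⟩
    refine ⟨t ^ 2 * C, fun n => ?_⟩
    rw [graphEnergy_smul]
    gcongr
    exact hC n

theorem const_mem_finiteEnergySubmodule (t : ℝ) :
    ContinuousMap.const K t ∈ finiteEnergySubmodule :=
  ⟨0, fun _ => (graphEnergy_const _ _ _ _ _).le⟩

theorem mem_finiteEnergySubmodule_of_comp {u : C(K, ℝ)}
    (h : ∀ i, u.comp (F i) ∈ finiteEnergySubmodule) : u ∈ finiteEnergySubmodule := by
  choose C hC using h
  have hC0 : ∀ i, 0 ≤ C i := fun i =>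
    (graphEnergy_nonneg (by norm_num) (by norm_num) (by norm_num) 0 _).trans (hC i 0)
  -- One level of refinement multiplies the reference coefficients by `2` and `3/2`, both at most
  -- `2`; the level `0` has no cells to split and is added separately.
  refine ⟨graphEnergy 1 1 1 0 u + ∑ i, 2 * C i, fun n => ?_⟩
  have h0 := graphEnergy_nonneg (zero_le_one' ℝ) (zero_le_one' ℝ) (zero_le_one' ℝ) 0 u
  cases n with
  | zero =>
    have : 0 ≤ ∑ i, 2 * C i := Finset.sum_nonneg fun i _ => by linarith [hC0 i]
    simpa using this
  | succ n =>
    rw [graphEnergy_succ]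
    refine le_add_of_nonneg_of_le h0 (Finset.sum_le_sum fun i _ => ?_)
    refine le_trans ?_ (mul_le_mul_of_nonneg_left (hC i n) zero_le_two)
    rw [← graphEnergy_mul_coeff]
    have : (0 : ℝ) < (3 / 2) ^ n := by positivity
    refine graphEnergy_mono_coeff ?_ ?_ ?_ _ _ <;> rw [pow_succ] <;> linarith

theorem mem_finiteEnergySubmodule_comp {u : C(K, ℝ)} (h : u ∈ finiteEnergySubmodule) (i : Fin 3) :
    u.comp (F i) ∈ finiteEnergySubmodule := by
  obtain ⟨C, hC⟩ := h
  refine ⟨C, fun n => (le_trans ?_ (hC (n + 1)))⟩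
  have h2 : (0 : ℝ) < 2 ^ n := by positivity
  have h3 : (0 : ℝ) < (3 / 2) ^ n := by positivity
  rw [graphEnergy_succ]
  refine le_trans ?_ (Finset.single_le_sum (fun j _ => graphEnergy_nonneg (by positivity)
    (by positivity) (by positivity) n (u.comp (F j))) (Finset.mem_univ i))
  refine graphEnergy_mono_coeff ?_ ?_ ?_ _ _ <;> rw [pow_succ] <;> linarith

theorem mem_finiteEnergySubmodule_of_abs_sub_le {u v : C(K, ℝ)} (hv : v ∈ finiteEnergySubmodule)
    (h : ∀ x y, |u x - u y| ≤ |v x - v y|) : u ∈ finiteEnergySubmodule := by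
  obtain ⟨C, hC⟩ := hv
  exact ⟨C, fun n => (graphEnergy_le_of_abs_sub_le (by positivity) (by positivity) (by positivity)
    n h).trans (hC n)⟩

namespace IsNetwork

variable {a b : ℕ → ℝ}

theorem graphEnergy_nonneg (h : IsNetwork a b) (n k : ℕ) (u : C(K, ℝ)) :
    0 ≤ graphEnergy (a n) (b n) (b n) k u :=
  SG.graphEnergy_nonneg (h.a_pos n).le (h.b_pos n).le (h.b_pos n).le k u

theorem monotone_graphEnergy (h : IsNetwork a b) (u : C(K, ℝ)) :
    Monotone fun n => graphEnergy (a n) (b n) (b n) n u :=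
  monotone_nat_of_le_succ fun n =>
    graphEnergy_le_succ (h.a_pos _) (h.b_pos _) (h.b_eq n) (h.a_eq n) n u

theorem tendsto_networkEnergy (h : IsNetwork a b) (u : C(K, ℝ)) :
    Tendsto (fun n => ENNReal.ofReal (graphEnergy (a n) (b n) (b n) n u)) atTop
      (𝓝 (networkEnergy a b u)) :=
  tendsto_atTop_iSup fun _ _ hmn => ENNReal.ofReal_le_ofReal (h.monotone_graphEnergy u hmn)

/-- The limit of `graphEnergy_succ`: the cells of level `n + 1` inside `F_i(K)` are cells of level
`n` for `u ∘ F_i`, but they keep the coefficients of level `n + 1`, hence the shift. -/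
theorem networkEnergy_eq_sum (h : IsNetwork a b) (u : C(K, ℝ)) :
    networkEnergy a b u =
      ∑ i, networkEnergy (fun n => a (1 + n)) (fun n => b (1 + n)) (u.comp (F i)) := by
  have h1 := (h.tendsto_networkEnergy u).comp (tendsto_add_atTop_nat 1)
  have h2 := tendsto_finsetSum (Finset.univ : Finset (Fin 3)) fun i _ =>
    (h.shift 1).tendsto_networkEnergy (u.comp (F i))
  refine tendsto_nhds_unique h1 (h2.congr fun n => ?_)
  rw [Function.comp_apply, graphEnergy_succ, ENNReal.ofReal_sum_of_nonneg fun i _ =>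
    h.graphEnergy_nonneg _ _ _, add_comm n 1]

theorem graphEnergy_le_toReal (h : IsNetwork a b) {u : C(K, ℝ)} (hu : networkEnergy a b u ≠ ∞)
    (n : ℕ) : graphEnergy (a n) (b n) (b n) n u ≤ (networkEnergy a b u).toReal := by
  have h1 : ENNReal.ofReal (graphEnergy (a n) (b n) (b n) n u) ≤ networkEnergy a b u :=
    le_iSup (fun n => ENNReal.ofReal (graphEnergy (a n) (b n) (b n) n u)) n
  have := ENNReal.toReal_mono hu h1
  rwa [ENNReal.toReal_ofReal (h.graphEnergy_nonneg _ _ _)] at this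

theorem networkEnergy_le_ofReal {u : C(K, ℝ)} {C : ℝ}
    (hC : ∀ n, graphEnergy (a n) (b n) (b n) n u ≤ C) : networkEnergy a b u ≤ ENNReal.ofReal C :=
  iSup_le fun n => ENNReal.ofReal_le_ofReal (hC n)

theorem exists_comparison (h : IsNetwork a b) : ∃ C > 0, ∀ n,
    a n ≤ C * 2 ^ n ∧ 2 ^ n ≤ C * a n ∧ b n ≤ C * (3 / 2) ^ n ∧ (3 / 2) ^ n ≤ C * b n := by
  obtain ⟨C, hC, h1⟩ := h.a_comparable
  obtain ⟨D, hD, h2⟩ := h.b_comparable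
  refine ⟨C + D, by positivity, fun n => ⟨(h1 n).1.trans ?_, (h1 n).2.trans ?_,
    (h2 n).1.trans ?_, (h2 n).2.trans ?_⟩⟩
  · gcongr; linarith
  · have := h.a_pos n; gcongr; linarith
  · gcongr; linarith
  · have := h.b_pos n; gcongr; linarith

theorem networkEnergy_ne_top_iff (h : IsNetwork a b) {u : C(K, ℝ)} :
    networkEnergy a b u ≠ ∞ ↔ u ∈ finiteEnergySubmodule := by
  obtain ⟨C, hC, hab⟩ := h.exists_comparison
  constructor
  · intro hu
    refine ⟨C * (networkEnergy a b u).toReal, fun n => ?_⟩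
    refine le_trans ?_ (mul_le_mul_of_nonneg_left (h.graphEnergy_le_toReal hu n) hC.le)
    rw [← graphEnergy_mul_coeff]
    exact graphEnergy_mono_coeff (hab n).2.1 (hab n).2.2.2 (hab n).2.2.2 _ _
  · rintro ⟨D, hD⟩
    refine ne_top_of_le_ne_top ENNReal.ofReal_ne_top (networkEnergy_le_ofReal (C := C * D)
      fun n => ?_)
    refine le_trans ?_ (mul_le_mul_of_nonneg_left (hD n) hC.le)
    rw [← graphEnergy_mul_coeff]
    exact graphEnergy_mono_coeff (hab n).1 (hab n).2.2.1 (hab n).2.2.1 _ _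

theorem tendsto_graphEnergy (h : IsNetwork a b) {u : C(K, ℝ)} (hu : u ∈ finiteEnergySubmodule) :
    Tendsto (fun n => graphEnergy (a n) (b n) (b n) n u) atTop
      (𝓝 (networkEnergy a b u).toReal) :=
  ((ENNReal.tendsto_toReal (h.networkEnergy_ne_top_iff.2 hu)).comp
    (h.tendsto_networkEnergy u)).congr fun _ => ENNReal.toReal_ofReal (h.graphEnergy_nonneg _ _ _)

end IsNetwork

/-! ### Oscillation -/

theorem abs_vertex_sub_le {a b M : ℝ} (hb : 0 < b) (hab : b ≤ a) {u : C(K, ℝ)}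
    (hM : graphEnergy a b b 0 u ≤ M) (i j : Fin 3) :
    |u (vertex i) - u (vertex j)| ≤ √(M / b) := by
  apply Real.abs_le_sqrt
  rw [le_div_iff₀ hb]
  refine le_trans ?_ hM
  rw [graphEnergy_zero]
  have h1 : b * (u (vertex 1) - u (vertex 2)) ^ 2 ≤ a * (u (vertex 1) - u (vertex 2)) ^ 2 := by
    gcongr
  have h2 : 0 ≤ b * (u (vertex 1) - u (vertex 2)) ^ 2 := by positivity
  have h3 : 0 ≤ b * (u (vertex 0) - u (vertex 2)) ^ 2 := by positivity
  have h4 : 0 ≤ b * (u (vertex 0) - u (vertex 1)) ^ 2 := by positivity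
  fin_cases i <;> fin_cases j <;>
    simp only [Fin.zero_eta, Fin.mk_one, Fin.reduceFinMk] <;> linarith

/-- Chaining along the cells that contain a vertex of level `n`. -/
theorem abs_wordMap_vertex_sub_le {M : ℝ} (n : ℕ) {a b : ℕ → ℝ} (hb : ∀ n, 0 < b n)
    (hab : ∀ n, b n ≤ a n) {u : C(K, ℝ)} (hM : ∀ k, graphEnergy (a k) (b k) (b k) k u ≤ M)
    (ω : Fin n → Fin 3) (j l : Fin 3) :
    |u (wordMap n ω (vertex j)) - u (vertex l)| ≤ ∑ k ∈ Finset.range (n + 1), √(M / b k) := by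
  induction n generalizing a b u l with
  | zero =>
    simpa [wordMap] using abs_vertex_sub_le (hb 0) (hab 0) (hM 0) j l
  | succ n ih =>
    rw [Finset.sum_range_succ']
    -- The chain passes through the corner of index `ω 0`, the fixed point of the first map: it lies
    -- both in `V₀` and in the cell `ω 0`, so one edge of level `0` leads on to `vertex l`.
    have h1 := ih (a := fun n => a (n + 1)) (b := fun n => b (n + 1)) (u := u.comp (F (ω 0)))
      (fun _ => hb _) (fun _ => hab _) (fun k => ?_) (Fin.tail ω) (ω 0)
    · rw [ContinuousMap.comp_apply, ContinuousMap.comp_apply, F_vertex_self,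
        ← wordMap_succ] at h1
      have h2 := abs_vertex_sub_le (hb 0) (hab 0) (hM 0) (ω 0) l
      exact (abs_sub_le _ (u (vertex (ω 0))) _).trans (add_le_add h1 h2)
    · refine le_trans ?_ (hM (k + 1))
      have hbk := hb (k + 1)
      have hak := hbk.trans_le (hab (k + 1))
      rw [graphEnergy_succ]
      exact Finset.single_le_sum (f := fun i => graphEnergy (a (k + 1)) (b (k + 1)) (b (k + 1)) k
        (u.comp (F i))) (fun j _ => graphEnergy_nonneg hak.le hbk.le hbk.le k _)
        (Finset.mem_univ (ω 0))

/-- Since `b k` is at least of order `(3/2) ^ k`, the chain of `abs_wordMap_vertex_sub_le` is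
dominated by a geometric series of ratio `√(2/3)`. The bound extends from the vertices of all levels
to `K` by density. -/
theorem IsNetwork.exists_abs_sub_le {a b : ℕ → ℝ} (h : IsNetwork a b) :
    ∃ B > 0, ∀ (u : C(K, ℝ)) (M : ℝ), (∀ k, graphEnergy (a k) (b k) (b k) k u ≤ M) →
      ∀ x y, |u x - u y| ≤ B * √M := by
  obtain ⟨C, hC, hab⟩ := h.exists_comparison
  set r := √(2 / 3 : ℝ) with hr
  have hr0 : 0 ≤ r := Real.sqrt_nonneg _
  have hr1 : r < 1 := by
    rw [hr, Real.sqrt_lt' one_pos]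
    norm_num
  refine ⟨2 * (√C / (1 - r)), by have := sub_pos.2 hr1; positivity, fun u M hM x y => ?_⟩
  have hM0 : 0 ≤ M := (h.graphEnergy_nonneg 0 0 u).trans (hM 0)
  have hvert : ∀ n (ω : Fin n → Fin 3),
      |u (wordMap n ω (vertex 0)) - u (vertex 0)| ≤ √C / (1 - r) * √M := by
    intro n ω
    refine (abs_wordMap_vertex_sub_le n h.b_pos h.b_le_a hM ω 0 0).trans ?_
    have hk : ∀ k, √(M / b k) ≤ √M * √C * r ^ k := by
      intro k
      have hb := h.b_pos k
      have e : r ^ k = √((2 / 3) ^ k) := by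
        rw [hr, Real.sqrt_eq_rpow, Real.sqrt_eq_rpow, ← Real.rpow_natCast, ← Real.rpow_natCast,
          ← Real.rpow_mul (by norm_num), ← Real.rpow_mul (by norm_num), mul_comm]
      rw [e, ← Real.sqrt_mul hM0, ← Real.sqrt_mul (by positivity)]
      apply Real.sqrt_le_sqrt
      rw [div_le_iff₀ hb]
      have h1 : (2 / 3 : ℝ) ^ k * (3 / 2) ^ k = 1 := by rw [← mul_pow]; norm_num
      calc M = M * ((2 / 3) ^ k * (3 / 2) ^ k) := by rw [h1, mul_one]
        _ ≤ M * ((2 / 3) ^ k * (C * b k)) := by gcongr; exact (hab k).2.2.2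
        _ = _ := by ring
    calc ∑ k ∈ Finset.range (n + 1), √(M / b k)
        ≤ ∑ k ∈ Finset.range (n + 1), √M * √C * r ^ k := Finset.sum_le_sum fun k _ => hk k
      _ = √M * √C * ∑ k ∈ Finset.range (n + 1), r ^ k := by rw [Finset.mul_sum]
      _ ≤ √M * √C * (1 - r)⁻¹ := by
          gcongr
          rw [← tsum_geometric_of_lt_one hr0 hr1]
          exact (summable_geometric_of_lt_one hr0 hr1).sum_le_tsum _ fun _ _ => by positivity
      _ = _ := by ring
  have hpt : ∀ x, |u x - u (vertex 0)| ≤ √C / (1 - r) * √M := by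
    intro x
    choose ω y hy using fun n => exists_wordMap_eq n x
    have ht : Tendsto (fun n => wordMap n (ω n) (vertex 0)) atTop (𝓝 x) := by
      rw [tendsto_iff_dist_tendsto_zero]
      refine squeeze_zero (fun _ => dist_nonneg) (fun n => ?_)
        (tendsto_half_pow_mul (Metric.diam (Set.univ : Set K)))
      conv_lhs => rw [← hy n, dist_wordMap]
      gcongr
      exact dist_le_diam _ _
    have ht' := (((u.continuous.tendsto x).comp ht).sub_const (u (vertex 0))).abs
    exact le_of_tendsto ht' (Eventually.of_forall fun n => hvert n (ω n))
  calc |u x - u y| ≤ |u x - u (vertex 0)| + |u (vertex 0) - u y| := abs_sub_le _ _ _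
    _ ≤ √C / (1 - r) * √M + √C / (1 - r) * √M := by
        gcongr
        · exact hpt x
        · rw [abs_sub_comm]; exact hpt y
    _ = _ := by ring

/-! ### The Hausdorff measure on the gasket -/

/-- The dimension `log 3 / log 2` of the gasket. -/
noncomputable def dimension : ℝ := Real.log 3 / Real.log 2

theorem dimension_pos : 0 < dimension :=
  div_pos (Real.log_pos (by norm_num)) (Real.log_pos (by norm_num))

theorem two_rpow_dimension : (2 : ℝ) ^ dimension = 3 := by
  rw [dimension, Real.rpow_def_of_pos two_pos, mul_div_cancel₀ _ (Real.log_pos one_lt_two).ne',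
    Real.exp_log three_pos]

theorem half_pow_rpow_dimension (n : ℕ) : ((1 / 2 : ℝ) ^ n) ^ dimension = (1 / 3) ^ n := by
  rw [← Real.rpow_natCast, ← Real.rpow_mul (by norm_num), mul_comm, Real.rpow_mul (by norm_num),
    Real.div_rpow (by norm_num) (by norm_num), two_rpow_dimension, Real.one_rpow,
    Real.rpow_natCast]

/-- Cover by the `3 ^ n` cells, whose diameters raised to the dimension are at most a constant times
`3 ^ (-n)`. Finiteness matters because normalizing by an infinite mass would give the zero measure.
-/
theorem hausdorff_univ_lt_top : hausdorff Set.univ < ∞ := by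
  set d := Metric.diam (Set.univ : Set K) with hd
  have hdiam : ∀ n (ω : Fin n → Fin 3), Metric.ediam (Set.range (wordMap n ω)) ≤
      ENNReal.ofReal ((1 / 2) ^ n * d) := by
    intro n ω
    refine Metric.ediam_le ?_
    rintro _ ⟨x, rfl⟩ _ ⟨y, rfl⟩
    rw [edist_dist, dist_wordMap]
    gcongr
    exact dist_le_diam x y
  have h := Measure.hausdorffMeasure_le_liminf_sum dimension (Set.univ : Set K) (l := atTop)
    (fun n : ℕ => ENNReal.ofReal ((1 / 2) ^ n * d))
    (by simpa using ENNReal.tendsto_ofReal (tendsto_half_pow_mul d))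
    (fun n ω => Set.range (wordMap n ω)) (Eventually.of_forall hdiam)
    (Eventually.of_forall fun n x _ => by
      obtain ⟨ω, y, rfl⟩ := exists_wordMap_eq n x
      exact Set.mem_iUnion.2 ⟨ω, y, rfl⟩)
  refine lt_of_le_of_lt h (lt_of_le_of_lt (liminf_le_of_frequently_le'
    (Frequently.of_forall fun n => ?_)) (ENNReal.ofReal_lt_top (r := d ^ dimension)))
  have hd0 : 0 ≤ d := Metric.diam_nonneg
  calc ∑ ω, Metric.ediam (Set.range (wordMap n ω)) ^ dimension
      ≤ ∑ ω : Fin n → Fin 3, ENNReal.ofReal ((1 / 2) ^ n * d) ^ dimension :=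
        Finset.sum_le_sum fun ω _ => ENNReal.rpow_le_rpow (hdiam n ω) dimension_pos.le
    _ = ENNReal.ofReal (3 ^ n * ((1 / 3) ^ n * d ^ dimension)) := by
        rw [Finset.sum_const, Finset.card_univ, Fintype.card_fun, Fintype.card_fin, Fintype.card_fin,
          ENNReal.ofReal_rpow_of_nonneg (by positivity) dimension_pos.le,
          Real.mul_rpow (by positivity) hd0, half_pow_rpow_dimension,
          ← ENNReal.ofReal_nsmul, nsmul_eq_mul]
        norm_cast
    _ ≤ ENNReal.ofReal (d ^ dimension) := by
        rw [← mul_assoc, ← mul_pow]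
        norm_num

/-! ### Coding of the points of the gasket -/

/-- The point of the plane with the address `σ`. -/
noncomputable def addressMap (σ : ℕ → Fin 3) : ℂ := ∑' k, (1 / 2 : ℂ) ^ (k + 1) * p (σ k)

theorem norm_p_le_one (i : Fin 3) : ‖p i‖ ≤ 1 := by
  fin_cases i
  · simp [p]
  · simp [p]
  · have : (Real.pi * Complex.I / 3 : ℂ) = ((Real.pi / 3 : ℝ) : ℂ) * Complex.I := by
      push_cast; ring
    simp only [p, Fin.reduceFinMk, Matrix.cons_val, this, Complex.norm_exp_ofReal_mul_I, le_refl]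

theorem norm_address_term_le (σ : ℕ → Fin 3) (k : ℕ) :
    ‖(1 / 2 : ℂ) ^ (k + 1) * p (σ k)‖ ≤ (1 / 2) ^ k := by
  rw [norm_mul, norm_pow, pow_succ]
  have : ‖(1 / 2 : ℂ)‖ = 1 / 2 := by simp
  rw [this]
  have h := norm_p_le_one (σ k)
  have h' := norm_nonneg (p (σ k))
  have : (0 : ℝ) < (1 / 2) ^ k := by positivity
  nlinarith

theorem summable_half_pow : Summable fun k : ℕ => (1 / 2 : ℝ) ^ k :=
  summable_geometric_of_lt_one (by norm_num) (by norm_num)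

theorem summable_address (σ : ℕ → Fin 3) : Summable fun k => (1 / 2 : ℂ) ^ (k + 1) * p (σ k) :=
  Summable.of_norm_bounded summable_half_pow (norm_address_term_le σ)

theorem continuous_addressMap : Continuous addressMap := by
  refine continuous_tsum (fun k => ?_) summable_half_pow (fun k σ => norm_address_term_le σ k)
  exact continuous_const.mul ((continuous_of_discreteTopology (f := p)).comp (continuous_apply k))

theorem addressMap_eq (σ : ℕ → Fin 3) :
    addressMap σ = planeMap (σ 0) (addressMap fun k => σ (k + 1)) := by
  rw [addressMap, (summable_address σ).tsum_eq_zero_add, planeMap, addressMap, mul_sub,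
    ← tsum_mul_left]
  have : ∀ k, (1 / 2 : ℂ) ^ (k + 1 + 1) * p (σ (k + 1)) =
      1 / 2 * ((1 / 2 : ℂ) ^ (k + 1) * p (σ (k + 1))) := fun k => by ring
  simp only [this]
  ring

theorem addressMap_mem (σ : ℕ → Fin 3) : addressMap σ ∈ (gasket : Set ℂ) := by
  have hpart : ∀ n (σ : ℕ → Fin 3),
      ∑ k ∈ Finset.range n, (1 / 2 : ℂ) ^ (k + 1) * p (σ k) ∈ (gasket : Set ℂ) := by
    intro n
    induction n with
    -- The empty partial sum is `0 = p₁`, so every partial sum is the image of `p₁` under a finite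
    -- word.
    | zero => intro σ; simpa [p] using p_mem 0
    | succ n ih =>
      intro σ
      have h := planeMap_mem (σ 0) (ih fun k => σ (k + 1))
      convert h using 1
      rw [Finset.sum_range_succ', planeMap, mul_sub, Finset.mul_sum]
      have : ∀ k, (1 / 2 : ℂ) ^ (k + 1 + 1) * p (σ (k + 1)) =
          1 / 2 * ((1 / 2 : ℂ) ^ (k + 1) * p (σ (k + 1))) := fun k => by ring
      simp only [this]
      ring
  exact gasket.isCompact.isClosed.mem_of_tendsto (summable_address σ).hasSum.tendsto_sum_nat
    (Eventually.of_forall fun n => hpart n σ)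

/-- The coding map of the gasket. -/
noncomputable def coding (σ : ℕ → Fin 3) : K := ⟨addressMap σ, addressMap_mem σ⟩

theorem continuous_coding : Continuous coding := continuous_addressMap.subtype_mk _

theorem coding_mem_range (n : ℕ) (σ : ℕ → Fin 3) :
    coding σ ∈ Set.range (wordMap n fun i => σ i) := by
  induction n generalizing σ with
  | zero => exact ⟨coding σ, rfl⟩
  | succ n ih =>
    obtain ⟨x, hx⟩ := ih fun k => σ (k + 1)
    refine ⟨x, ?_⟩
    rw [wordMap_succ]
    have : Fin.tail (fun i : Fin (n + 1) => σ i) = fun i : Fin n => σ (i + 1) := by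
      funext i
      simp [Fin.tail]
    rw [this, hx]
    exact Subtype.ext (addressMap_eq σ).symm

/-! ### The uniform measure on the code space -/

/-- The uniform product measure on the infinite words. -/
noncomputable def codeMeasure : Measure (ℕ → Fin 3) :=
  Measure.infinitePi fun _ => ProbabilityTheory.uniformOn Set.univ

theorem codeMeasure_cylinder {n : ℕ} (ω : Fin n → Fin 3) :
    codeMeasure {σ | ∀ i : Fin n, σ i = ω i} = (1 / 3) ^ n := by
  have e : {σ : ℕ → Fin 3 | ∀ i : Fin n, σ i = ω i} = ((Finset.range n : Finset ℕ) : Set ℕ).pi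
      fun k => if h : k < n then {ω ⟨k, h⟩} else Set.univ := by
    ext σ
    simp only [Set.mem_ofPred_eq, Set.mem_pi, Finset.coe_range, Set.mem_Iio]
    constructor
    · intro h k hk
      simpa [hk] using h ⟨k, hk⟩
    · intro h i
      simpa [i.2] using h i i.2
  rw [e, codeMeasure, Measure.infinitePi_pi _ fun _ _ => MeasurableSet.of_discrete]
  rw [Finset.prod_congr rfl (g := fun _ => (1 / 3 : ℝ≥0∞)), Finset.prod_const, Finset.card_range]
  intro k hk
  rw [dif_pos (Finset.mem_range.1 hk), ProbabilityTheory.uniformOn_univ]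
  simp

/-- The corner `F_ω(p₁)` of a cell of level `n` lies on the lattice of mesh `2⁻ⁿ`. -/
theorem exists_corner_coordinates (n : ℕ) (ω : Fin n → Fin 3) :
    ∃ k l : ℕ, k < 2 ^ n ∧ l < 2 ^ n ∧ bary 1 (wordMap n ω (vertex 0)) = k / 2 ^ n ∧
      bary 2 (wordMap n ω (vertex 0)) = l / 2 ^ n := by
  induction n with
  | zero =>
    refine ⟨0, 0, by norm_num, by norm_num, ?_, ?_⟩ <;> simp [wordMap, vertex, bary_p]
  | succ n ih =>
    obtain ⟨k, l, hk, hl, h1, h2⟩ := ih (Fin.tail ω)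
    refine ⟨k + if ω 0 = 1 then 2 ^ n else 0, l + if ω 0 = 2 then 2 ^ n else 0, ?_, ?_, ?_, ?_⟩
    · rw [pow_succ]; split_ifs <;> omega
    · rw [pow_succ]; split_ifs <;> omega
    · rw [wordMap_succ, F_coe, bary_planeMap, h1]
      split_ifs <;> push_cast <;> field_simp <;> ring
    · rw [wordMap_succ, F_coe, bary_planeMap, h2]
      split_ifs <;> push_cast <;> field_simp <;> ring

/-- Cells with different first letters `i ≠ j` could share this corner only if the corners of their
tails were `p_j` and `p_i`. One of these is not `p₁`, whereas a corner `F_ω(p₁)` has second and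
third coordinates below `1`. -/
theorem wordMap_vertex_zero_injective (n : ℕ) :
    Function.Injective fun ω : Fin n → Fin 3 => wordMap n ω (vertex 0) := by
  induction n with
  | zero => intro ω ω' _; exact Subsingleton.elim _ _
  | succ n ih =>
    intro ω ω' h
    simp only [wordMap_succ] at h
    have hne : ∀ (τ : Fin n → Fin 3) (i : Fin 3), i ≠ 0 → wordMap n τ (vertex 0) ≠ vertex i := by
      intro τ i hi h
      obtain ⟨k, l, hk, hl, h1, h2⟩ := exists_corner_coordinates n τ
      rw [h] at h1 h2
      have hk' : (k : ℝ) / 2 ^ n < 1 := by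
        rw [div_lt_one (by positivity)]; exact_mod_cast hk
      have hl' : (l : ℝ) / 2 ^ n < 1 := by
        rw [div_lt_one (by positivity)]; exact_mod_cast hl
      simp only [vertex, bary_p] at h1 h2
      fin_cases i
      · exact hi rfl
      · simp at h1; linarith
      · simp at h2; linarith
    have h0 : ω 0 = ω' 0 := by
      by_contra hne'
      obtain ⟨h1, h2⟩ := F_eq_F hne' h
      by_cases hz : ω' 0 = 0
      · exact hne _ _ (fun h => hne' (h.trans hz.symm)) h2
      · exact hne _ _ hz h1
    rw [h0] at h
    have ht : Fin.tail ω = Fin.tail ω' := ih (F_injective _ h)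
    rw [← Fin.cons_self_tail ω, ← Fin.cons_self_tail ω', h0, ht]

open Classical in
/-- The number of cells of level `n` that meet a set of diameter `2⁻ⁿ` is bounded. -/
theorem card_cells_le {n : ℕ} {s : Set K}
    (hs : ∀ x ∈ s, ∀ y ∈ s, dist x y ≤ (1 / 2) ^ n) :
    (Finset.univ.filter fun ω : Fin n → Fin 3 => (Set.range (wordMap n ω) ∩ s).Nonempty).card
      ≤ 81 := by
  set S := Finset.univ.filter fun ω : Fin n → Fin 3 => (Set.range (wordMap n ω) ∩ s).Nonempty
    with hS
  rcases S.eq_empty_or_nonempty with h | ⟨τ, hτ⟩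
  · rw [h]; simp
  choose k l _ _ hk hl using exists_corner_coordinates n
  -- The `4` is `1 + 2 + 1`: a coordinate varies by at most `2 ^ (-n)` within each of the two cells,
  -- and by at most twice the distance across `s`.
  have key : ∀ j ω x, wordMap n ω x ∈ s → ∀ y, wordMap n τ y ∈ s →
      |bary j (wordMap n ω (vertex 0)) - bary j (wordMap n τ (vertex 0))| ≤ 4 / 2 ^ n := by
    intro j ω x hx y hy
    have hcell : ∀ (ω : Fin n → Fin 3) (x y : K),
        |bary j (wordMap n ω x) - bary j (wordMap n ω y)| ≤ 1 / 2 ^ n := by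
      have : ∀ m (ω : Fin m → Fin 3) (x y : K),
        |bary j (wordMap m ω x) - bary j (wordMap m ω y)| ≤ 1 / 2 ^ m := by
        intro m
        induction m with
        | zero =>
          intro ω x y
          simp only [wordMap, ContinuousMap.id_apply]
          rw [abs_le]
          have := bary_nonneg j x.2
          have := bary_nonneg j y.2
          have := bary_le_one j x.2
          have := bary_le_one j y.2
          constructor <;> norm_num <;> linarith
        | succ m ih =>
          intro ω x y
          rw [wordMap_succ, wordMap_succ, F_coe, F_coe, bary_planeMap, bary_planeMap]
          have h := ih (Fin.tail ω) x y
          rw [← sub_div, add_sub_add_right_eq_sub, abs_div, abs_two, pow_succ, ← div_div]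
          gcongr
      exact this n
    have h1 := hcell ω (vertex 0) x
    have h2 := hcell τ y (vertex 0)
    have h3 := (abs_bary_sub_le j (wordMap n ω x) (wordMap n τ y)).trans
      (mul_le_mul_of_nonneg_left (hs _ hx _ hy) zero_le_two)
    have e : (4 : ℝ) / 2 ^ n = 1 / 2 ^ n + 2 * (1 / 2) ^ n + 1 / 2 ^ n := by
      rw [one_div_pow]; ring
    rw [e]
    rw [abs_le] at h1 h2 h3 ⊢
    constructor <;> linarith [h1.1, h1.2, h2.1, h2.2, h3.1, h3.2]
  -- Lattice indices within `4` of each other take `9` values per coordinate, hence `81 = 9 * 9`.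
  -- The shift by `4` keeps the natural subtraction from truncating; `j ≤ i + 4` is recorded so that
  -- it can be undone.
  have hint : ∀ i j : ℕ, |(i : ℝ) / 2 ^ n - j / 2 ^ n| ≤ 4 / 2 ^ n → i + 4 - j ∈ Finset.range 9 ∧
      j ≤ i + 4 := by
    intro i j h
    rw [← sub_div, abs_div, abs_of_pos (by positivity : (0 : ℝ) < 2 ^ n),
      div_le_div_iff_of_pos_right (by positivity), abs_le] at h
    have h1 : j ≤ i + 4 := by
      have : (j : ℝ) ≤ i + 4 := by linarith
      exact_mod_cast this
    have h2 : i ≤ j + 4 := by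
      have : (i : ℝ) ≤ j + 4 := by linarith
      exact_mod_cast this
    rw [Finset.mem_range]
    omega
  obtain ⟨_, ⟨y, rfl⟩, hy⟩ := (Finset.mem_filter.1 hτ).2
  have hcoord : ∀ ω ∈ S, (k ω + 4 - k τ ∈ Finset.range 9 ∧ k τ ≤ k ω + 4) ∧
      (l ω + 4 - l τ ∈ Finset.range 9 ∧ l τ ≤ l ω + 4) := by
    intro ω hω
    obtain ⟨_, ⟨x, rfl⟩, hx⟩ := (Finset.mem_filter.1 hω).2
    have h1 := key 1 ω x hx y hy
    have h2 := key 2 ω x hx y hy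
    rw [hk, hk] at h1
    rw [hl, hl] at h2
    exact ⟨hint _ _ h1, hint _ _ h2⟩
  calc S.card ≤ (Finset.range 9 ×ˢ Finset.range 9).card := by
        refine Finset.card_le_card_of_injOn (fun ω => (k ω + 4 - k τ, l ω + 4 - l τ))
          (fun ω hω => ?_) (fun ω hω ω' hω' h => ?_)
        · exact Finset.mem_coe.2 (Finset.mem_product.2 ⟨(hcoord ω hω).1.1, (hcoord ω hω).2.1⟩)
        · have c1 := hcoord ω hω
          have c2 := hcoord ω' hω'
          simp only [Prod.mk.injEq] at h
          have ek : k ω = k ω' := by omega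
          have el : l ω = l ω' := by omega
          apply wordMap_vertex_zero_injective n
          apply Subtype.ext
          have e1 : bary 1 (wordMap n ω (vertex 0)) = bary 1 (wordMap n ω' (vertex 0)) := by
            rw [hk, hk, ek]
          have e2 : bary 2 (wordMap n ω (vertex 0)) = bary 2 (wordMap n ω' (vertex 0)) := by
            rw [hl, hl, el]
          apply eq_of_bary_eq
          intro j
          have s1 := bary_sum (wordMap n ω (vertex 0))
          have s2 := bary_sum (wordMap n ω' (vertex 0))
          fin_cases j
          · show bary 0 _ = bary 0 _
            linarith
          · exact e1
          · exact e2
    _ = 81 := by simp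

/-- The image on the gasket of the uniform measure on the code space. -/
noncomputable def selfSimilarMeasure : Measure K := codeMeasure.map coding

/-- A code whose point lies in the closure of `s` starts with one of the at most `81` words whose
cells meet that closure, and each cylinder has mass `3 ^ (-n)`. The closure makes the preimage
measurable without enlarging distances. -/
theorem selfSimilarMeasure_le {n : ℕ} {s : Set K}
    (hs : ∀ x ∈ s, ∀ y ∈ s, dist x y ≤ (1 / 2) ^ n) :
    selfSimilarMeasure s ≤ 81 * (1 / 3) ^ n := by
  classical
  have hcl : ∀ x ∈ closure s, ∀ y ∈ closure s, dist x y ≤ (1 / 2) ^ n := by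
    intro x hx y hy
    exact map_mem_closure₂ continuous_dist hx hy (fun a ha b hb => hs a ha b hb)
      |> isClosed_Iic.closure_subset
  calc selfSimilarMeasure s ≤ selfSimilarMeasure (closure s) := measure_mono subset_closure
    _ = codeMeasure (coding ⁻¹' closure s) :=
        Measure.map_apply continuous_coding.measurable isClosed_closure.measurableSet
    _ ≤ codeMeasure (⋃ ω ∈ Finset.univ.filter fun ω : Fin n → Fin 3 =>
          (Set.range (wordMap n ω) ∩ closure s).Nonempty, {σ | ∀ i : Fin n, σ i = ω i}) := by
        refine measure_mono fun σ hσ => ?_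
        simp only [Set.mem_iUnion]
        exact ⟨fun i => σ i, Finset.mem_filter.2 ⟨Finset.mem_univ _,
          coding σ, coding_mem_range n σ, hσ⟩, fun i => rfl⟩
    _ ≤ ∑ ω ∈ Finset.univ.filter fun ω : Fin n → Fin 3 =>
          (Set.range (wordMap n ω) ∩ closure s).Nonempty, codeMeasure {σ | ∀ i : Fin n, σ i = ω i} :=
        measure_biUnion_finset_le _ _
    _ ≤ 81 * (1 / 3) ^ n := by
        simp only [codeMeasure_cylinder, Finset.sum_const, nsmul_eq_mul]
        gcongr
        exact_mod_cast card_cells_le hcl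

theorem exists_wordMap_range_subset {U : Set K} (hU : IsOpen U) {x : K} (hx : x ∈ U) :
    ∃ (n : ℕ) (ω : Fin n → Fin 3), Set.range (wordMap n ω) ⊆ U := by
  obtain ⟨ε, hε, hball⟩ := Metric.isOpen_iff.1 hU x hx
  obtain ⟨N, hN⟩ := exists_dist_wordMap_lt hε
  obtain ⟨ω, y, rfl⟩ := exists_wordMap_eq N x
  refine ⟨N, ω, ?_⟩
  rintro _ ⟨z, rfl⟩
  exact hball (hN N le_rfl ω z y)

theorem selfSimilarMeasure_pos {U : Set K} (hU : IsOpen U) (hne : U.Nonempty) :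
    0 < selfSimilarMeasure U := by
  obtain ⟨x, hx⟩ := hne
  obtain ⟨n, ω, hω⟩ := exists_wordMap_range_subset hU hx
  have h : (0 : ℝ≥0∞) < (1 / 3) ^ n := ENNReal.pow_pos (by simp) n
  refine h.trans_le ?_
  rw [← codeMeasure_cylinder ω, selfSimilarMeasure,
    Measure.map_apply continuous_coding.measurable hU.measurableSet]
  refine measure_mono fun σ hσ => ?_
  have : (fun i : Fin n => σ i) = ω := funext hσ
  exact hω (this ▸ coding_mem_range n σ)

/-- The diameter lies between two consecutive powers of `1/2`; rounding up costs one more factor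
`3`, so `243 = 3 * 81`. A set of diameter `0` is treated apart, by letting `n` tend to infinity. -/
theorem selfSimilarMeasure_le_ediam {s : Set K} (hs : Metric.ediam s ≤ 1) :
    selfSimilarMeasure s ≤ 243 * Metric.ediam s ^ dimension := by
  have hne : Metric.ediam s ≠ ∞ := ne_top_of_le_ne_top ENNReal.one_ne_top hs
  have hdist : ∀ x ∈ s, ∀ y ∈ s, dist x y ≤ (Metric.ediam s).toReal := fun x hx y hy => by
    rw [← ENNReal.ofReal_le_iff_le_toReal hne, ← edist_dist]
    exact Metric.edist_le_ediam_of_mem hx hy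
  rcases eq_or_ne (Metric.ediam s) 0 with h0 | h0
  · have h : ∀ n : ℕ, selfSimilarMeasure s ≤ 81 * (1 / 3) ^ n := fun n =>
      selfSimilarMeasure_le fun x hx y hy => (hdist x hx y hy).trans (by rw [h0]; simp)
    have ht : Tendsto (fun n : ℕ => (81 : ℝ≥0∞) * (1 / 3) ^ n) atTop (𝓝 (81 * 0)) :=
      ENNReal.Tendsto.const_mul (ENNReal.tendsto_pow_atTop_nhds_zero_of_lt_one
        (by simp)) (Or.inr (by simp))
    rw [mul_zero] at ht
    exact (ge_of_tendsto' ht h).trans zero_le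
  · set d := (Metric.ediam s).toReal with hd
    have hd0 : 0 < d := ENNReal.toReal_pos h0 hne
    have hd1 : d ≤ 1 := by
      simpa using ENNReal.toReal_mono ENNReal.one_ne_top hs
    obtain ⟨n, hn1, hn2⟩ := exists_nat_pow_near_of_lt_one hd0 hd1 (by norm_num : (0 : ℝ) < 1 / 2)
      (by norm_num)
    refine (selfSimilarMeasure_le fun x hx y hy => (hdist x hx y hy).trans hn2).trans ?_
    have e : Metric.ediam s = ENNReal.ofReal d := (ENNReal.ofReal_toReal hne).symm
    have e1 : (81 : ℝ≥0∞) * (1 / 3) ^ n = ENNReal.ofReal (81 * (1 / 3) ^ n) := by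
      rw [ENNReal.ofReal_mul (by norm_num), ENNReal.ofReal_pow (by norm_num),
        ENNReal.ofReal_div_of_pos (by norm_num)]
      simp
    have e2 : (243 : ℝ≥0∞) = ENNReal.ofReal 243 := by simp
    rw [e, ENNReal.ofReal_rpow_of_nonneg hd0.le dimension_pos.le, e1, e2,
      ← ENNReal.ofReal_mul (by norm_num)]
    apply ENNReal.ofReal_le_ofReal
    have h := Real.rpow_le_rpow (by positivity) hn1.le dimension_pos.le
    rw [half_pow_rpow_dimension, pow_succ] at h
    linarith

/-- Mass distribution principle: a measure bounded by a constant times the diameter to the power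
`dimension` is bounded by a constant times the Hausdorff measure, and the self-similar measure
charges every open set. -/
theorem hausdorff_pos {U : Set K} (hU : IsOpen U) (hne : U.Nonempty) : 0 < hausdorff U := by
  have hc : (243 : ℝ≥0∞)⁻¹ ≠ 0 := by simp
  have hle : (243 : ℝ≥0∞)⁻¹ • selfSimilarMeasure ≤ hausdorff := by
    refine Measure.le_mkMetric _ _ 1 one_pos fun s hs => ?_
    rw [Measure.smul_apply, smul_eq_mul]
    calc (243 : ℝ≥0∞)⁻¹ * selfSimilarMeasure s
        ≤ 243⁻¹ * (243 * Metric.ediam s ^ dimension) := by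
          gcongr
          exact selfSimilarMeasure_le_ediam hs
      _ = Metric.ediam s ^ dimension := by
          rw [← mul_assoc, ENNReal.inv_mul_cancel (by simp) (by simp), one_mul]
  refine lt_of_lt_of_le ?_ (hle U)
  rw [Measure.smul_apply, smul_eq_mul]
  exact ENNReal.mul_pos hc (selfSimilarMeasure_pos hU hne).ne'

instance : μ.IsOpenPosMeasure :=
  ⟨fun U hU hne => by
    rw [μ, Measure.smul_apply, smul_eq_mul]
    exact mul_ne_zero (ENNReal.inv_ne_zero.2 hausdorff_univ_lt_top.ne) (hausdorff_pos hU hne).ne'⟩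

/-! ### Functions of finite energy -/

theorem dist_le_of_comp {u v : C(K, ℝ)} {C : ℝ} (hC : 0 ≤ C)
    (h : ∀ i x, |u (F i x) - v (F i x)| ≤ C) : dist u v ≤ C := by
  rw [ContinuousMap.dist_le hC]
  intro x
  obtain ⟨i, y, rfl⟩ := exists_F_eq x
  rw [Real.dist_eq]
  exact h i y

/-- There is a continuous function with prescribed values on the boundary and prescribed affine
self-similarity, as soon as the data are compatible. -/
theorem exists_affine_selfSimilar (c : Fin 3 → ℝ) (hc : ∀ i, |c i| ≤ 2 / 3)
    (d : Fin 3 → C(K, ℝ)) (β : Fin 3 → ℝ) (hβ : ∀ i, c i * β i + d i (vertex i) = β i)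
    (hd : ∀ i j, c i * β j + d i (vertex j) = c j * β i + d j (vertex i)) :
    ∃ u : C(K, ℝ), (∀ i, u (vertex i) = β i) ∧ ∀ i x, u (F i x) = c i * u x + d i x := by
  let S : Set C(K, ℝ) := {u | ∀ i, u (vertex i) = β i}
  have hS : IsClosed S := by
    simp only [S, Set.ofPred_forall]
    exact isClosed_iInter fun i =>
      isClosed_eq (continuous_eval_const _) continuous_const
  have hglue : ∀ u : S, ∃ w : S, ∀ i x, w.1 (F i x) = c i * u.1 x + d i x := by
    rintro ⟨u, hu⟩
    obtain ⟨w, hw⟩ := exists_glue (fun i => c i • u + d i) (by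
      intro i j
      simp only [ContinuousMap.add_apply, ContinuousMap.smul_apply, smul_eq_mul, hu i, hu j]
      exact hd i j)
    have hw' : ∀ i x, w (F i x) = c i * u x + d i x := fun i x =>
      DFunLike.congr_fun (hw i) x
    refine ⟨⟨w, fun i => ?_⟩, hw'⟩
    rw [← F_vertex_self i, hw', hu i, hβ]
  choose T hT using hglue
  have hT' : ContractingWith (2 / 3) T := by
    refine ⟨by rw [← NNReal.coe_lt_coe]; norm_num, LipschitzWith.of_dist_le_mul fun u v => ?_⟩
    refine dist_le_of_comp (by positivity) fun i x => ?_
    rw [hT, hT, add_sub_add_right_eq_sub, ← mul_sub, abs_mul]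
    refine mul_le_mul (by simpa using hc i) ?_ (abs_nonneg _) (by positivity)
    rw [← Real.dist_eq]
    exact ContinuousMap.dist_apply_le_dist x
  have : Nonempty S := by
    refine ⟨⟨⟨fun x => ∑ i, β i * bary i x, ?_⟩, fun j => ?_⟩⟩
    · exact continuous_finsetSum _ fun i _ =>
        continuous_const.mul ((continuous_bary i).comp continuous_subtype_val)
    · simp [vertex, bary_p]
  have : CompleteSpace S := hS.completeSpace_coe
  refine ⟨(ContractingWith.fixedPoint T hT').1, (ContractingWith.fixedPoint T hT').2,
    fun i x => ?_⟩
  rw [← hT, ContractingWith.fixedPoint_isFixedPt hT']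

/-- On every cell the values at the two lower-indexed-by-`1, 2` corners agree, so the coefficient
`a` never enters its energy. Refining multiplies the energy for fixed coefficients by `4/9 + 1/9 +
1/9 = 2/3`, which cancels the growth of `b`. -/
theorem exists_height : ∃ h : C(K, ℝ),
    (h (vertex 0) = 0 ∧ h (vertex 1) = 1 ∧ h (vertex 2) = 1) ∧
    (∀ x, h (F 0 x) = 2 / 3 * h x + 0) ∧ (∀ x, h (F 1 x) = 1 / 3 * h x + 2 / 3) ∧
    ∀ x, h (F 2 x) = 1 / 3 * h x + 2 / 3 := by
  obtain ⟨h, h1, h2⟩ := exists_affine_selfSimilar ![2 / 3, 1 / 3, 1 / 3]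
    (by intro i; fin_cases i <;> simp [abs_of_pos] <;> norm_num)
    ![0, ContinuousMap.const K (2 / 3), ContinuousMap.const K (2 / 3)] ![0, 1, 1]
    (by intro i; fin_cases i <;> simp <;> norm_num)
    (by intro i j; fin_cases i <;> fin_cases j <;> simp)
  exact ⟨h, ⟨h1 0, h1 1, h1 2⟩, h2 0, h2 1, h2 2⟩

/-- A function that depends on the height only. -/
noncomputable def height : C(K, ℝ) := exists_height.choose

theorem height_vertex :
    height (vertex 0) = 0 ∧ height (vertex 1) = 1 ∧ height (vertex 2) = 1 :=
  exists_height.choose_spec.1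

theorem height_F : (∀ x, height (F 0 x) = 2 / 3 * height x + 0) ∧
    (∀ x, height (F 1 x) = 1 / 3 * height x + 2 / 3) ∧
    ∀ x, height (F 2 x) = 1 / 3 * height x + 2 / 3 :=
  exists_height.choose_spec.2

/-- The cell at `p₁` carries no variation, and the cross terms between `tilt` and `height` cancel
between the other two cells. For fixed coefficients the energy is thus halved at each refinement, up
to a contribution of `height`, and this absorbs `a ≍ 2 ^ n`. -/
theorem exists_tilt : ∃ g : C(K, ℝ),
    (g (vertex 0) = 0 ∧ g (vertex 1) = 1 ∧ g (vertex 2) = -1) ∧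
    g.comp (F 0) = 0 ∧ g.comp (F 1) = (1 / 2 : ℝ) • (g + height) ∧
    g.comp (F 2) = (1 / 2 : ℝ) • (g - height) := by
  obtain ⟨e0, e1, e2⟩ := height_vertex
  obtain ⟨g, h1, h2⟩ := exists_affine_selfSimilar ![0, 1 / 2, 1 / 2]
    (by intro i; fin_cases i <;> simp [abs_of_pos] <;> norm_num)
    ![0, (1 / 2 : ℝ) • height, (-1 / 2 : ℝ) • height] ![0, 1, -1]
    (by intro i; fin_cases i <;> simp [e1, e2] <;> norm_num)
    (by intro i j; fin_cases i <;> fin_cases j <;> simp [e0, e1, e2] <;> norm_num)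
  refine ⟨g, ⟨h1 0, h1 1, h1 2⟩, ?_, ?_, ?_⟩
  · ext x; simpa using h2 0 x
  · ext x
    have := h2 1 x
    simp at this
    simp [this]
  · ext x
    have := h2 2 x
    simp at this
    simp [this]
    ring

/-- A function with values `0, 1, -1` on the boundary. -/
noncomputable def tilt : C(K, ℝ) := exists_tilt.choose

theorem tilt_vertex : tilt (vertex 0) = 0 ∧ tilt (vertex 1) = 1 ∧ tilt (vertex 2) = -1 :=
  exists_tilt.choose_spec.1

theorem tilt_comp : tilt.comp (F 0) = 0 ∧ tilt.comp (F 1) = (1 / 2 : ℝ) • (tilt + height) ∧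
    tilt.comp (F 2) = (1 / 2 : ℝ) • (tilt - height) :=
  exists_tilt.choose_spec.2

theorem graphEnergy_of_affine {a b c t s : ℝ} (n : ℕ) {u v : C(K, ℝ)}
    (h : ∀ x, v x = t * u x + s) : graphEnergy a b c n v = t ^ 2 * graphEnergy a b c n u := by
  rw [graphEnergy, graphEnergy, Finset.mul_sum]
  refine Finset.sum_congr rfl fun _ _ => ?_
  simp only [h]
  ring

theorem graphEnergy_height (a b : ℝ) (n : ℕ) :
    graphEnergy a b b n height = 2 * b * (2 / 3) ^ n := by
  induction n with
  | zero =>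
    obtain ⟨e0, e1, e2⟩ := height_vertex
    rw [graphEnergy_zero, e0, e1, e2]
    ring
  | succ n ih =>
    rw [graphEnergy_succ, Fin.sum_univ_three,
      graphEnergy_of_affine (v := height.comp (F 0)) n height_F.1,
      graphEnergy_of_affine (v := height.comp (F 1)) n height_F.2.1,
      graphEnergy_of_affine (v := height.comp (F 2)) n height_F.2.2, ih]
    ring

theorem graphEnergy_tilt_le {a b : ℝ} (hb : 0 ≤ b) (n : ℕ) :
    graphEnergy a b b n tilt ≤ (4 * a + 2 * b) * (1 / 2) ^ n + 6 * b * (2 / 3) ^ n := by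
  induction n with
  | zero =>
    obtain ⟨e0, e1, e2⟩ := tilt_vertex
    rw [graphEnergy_zero, e0, e1, e2]
    linarith
  | succ n ih =>
    rw [graphEnergy_succ, Fin.sum_univ_three, tilt_comp.1, tilt_comp.2.1, tilt_comp.2.2,
      graphEnergy_smul, graphEnergy_smul, graphEnergy_add, graphEnergy_sub, graphEnergy_height]
    have h0 : graphEnergy a b b n 0 = 0 := graphEnergy_const _ _ _ 0 n
    have e1 : ((1 / 2 : ℝ)) ^ (n + 1) = (1 / 2) ^ n * (1 / 2) := pow_succ _ _
    have e2 : ((2 / 3 : ℝ)) ^ (n + 1) = (2 / 3) ^ n * (2 / 3) := pow_succ _ _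
    rw [h0, e1, e2]
    linarith

theorem height_mem : height ∈ finiteEnergySubmodule := by
  refine ⟨2, fun n => ?_⟩
  rw [graphEnergy_height, mul_assoc, ← mul_pow]
  norm_num

theorem tilt_mem : tilt ∈ finiteEnergySubmodule := by
  refine ⟨12, fun n => (graphEnergy_tilt_le (by positivity) n).trans ?_⟩
  rw [add_mul, mul_assoc, mul_assoc, mul_assoc, ← mul_pow, ← mul_pow, ← mul_pow]
  have : (3 / 2 * (1 / 2) : ℝ) ^ n ≤ 1 := pow_le_one₀ (by norm_num) (by norm_num)
  norm_num at this ⊢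
  linarith

/-! ### Uniform density -/

/-- A function of finite energy with the boundary values of `u`, close to `u` if the oscillation of
`u` is small. -/
theorem exists_finiteEnergy_interpolation :
    ∃ C > 0, ∀ (u : C(K, ℝ)) (δ : ℝ), (∀ x y, |u x - u y| ≤ δ) →
      ∃ v ∈ finiteEnergySubmodule, (∀ i, v (vertex i) = u (vertex i)) ∧
        ∀ x, |u x - v x| ≤ C * δ := by
  refine ⟨1 + ‖height‖ + ‖tilt‖, by positivity, fun u δ hu => ?_⟩
  set α₀ := u (vertex 0) with h0
  set α₁ := u (vertex 1) with h1
  set α₂ := u (vertex 2) with h2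
  obtain ⟨e0, e1, e2⟩ := height_vertex
  obtain ⟨t0, t1, t2⟩ := tilt_vertex
  refine ⟨ContinuousMap.const K α₀ + ((α₁ + α₂) / 2 - α₀) • height + ((α₁ - α₂) / 2) • tilt,
    ?_, fun i => ?_, fun x => ?_⟩
  · exact add_mem (add_mem (const_mem_finiteEnergySubmodule _)
      (Submodule.smul_mem _ _ height_mem)) (Submodule.smul_mem _ _ tilt_mem)
  · fin_cases i
    · simp [e0, t0, h0]
    · simp [e1, t1]; ring
    · simp [e2, t2]; ring
  · have d0 : |u x - α₀| ≤ δ := hu _ _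
    have dh : |(α₁ + α₂) / 2 - α₀| ≤ δ := by
      have d1 := abs_le.1 (hu (vertex 1) (vertex 0))
      have d2 := abs_le.1 (hu (vertex 2) (vertex 0))
      rw [abs_le]
      constructor <;> linarith [d1.1, d1.2, d2.1, d2.2]
    have dt : |(α₁ - α₂) / 2| ≤ δ := by
      have d1 := abs_le.1 (hu (vertex 1) (vertex 2))
      rw [abs_le]
      constructor <;> linarith [d1.1, d1.2]
    have hh : |height x| ≤ ‖height‖ := height.norm_coe_le_norm x
    have ht : |tilt x| ≤ ‖tilt‖ := tilt.norm_coe_le_norm x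
    have hδ : 0 ≤ δ := (abs_nonneg _).trans dt
    simp only [ContinuousMap.add_apply, ContinuousMap.const_apply, ContinuousMap.smul_apply,
      smul_eq_mul]
    calc |u x - (α₀ + ((α₁ + α₂) / 2 - α₀) * height x + (α₁ - α₂) / 2 * tilt x)|
        = |(u x - α₀) - ((α₁ + α₂) / 2 - α₀) * height x - (α₁ - α₂) / 2 * tilt x| := by
          congr 1; ring
      _ ≤ |u x - α₀| + |((α₁ + α₂) / 2 - α₀) * height x| + |(α₁ - α₂) / 2 * tilt x| :=
          (abs_sub _ _).trans (add_le_add_left (abs_sub _ _) _)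
      _ ≤ δ + δ * ‖height‖ + δ * ‖tilt‖ := by
          rw [abs_mul, abs_mul]
          gcongr
      _ = _ := by ring

/-- Interpolate on each cell of level `n` and glue. The constant does not depend on `n`, because
gluing only takes the maximum of the errors; the exact boundary values are what makes the pieces
fit. -/
theorem exists_finiteEnergy_spline : ∃ C > 0, ∀ (n : ℕ) (u : C(K, ℝ)) (δ : ℝ),
    (∀ (ω : Fin n → Fin 3) (x y : K), |u (wordMap n ω x) - u (wordMap n ω y)| ≤ δ) →
      ∃ v ∈ finiteEnergySubmodule, (∀ i, v (vertex i) = u (vertex i)) ∧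
        ∀ x, |u x - v x| ≤ C * δ := by
  obtain ⟨C, hC, h⟩ := exists_finiteEnergy_interpolation
  refine ⟨C, hC, fun n => ?_⟩
  induction n with
  | zero => exact fun u δ hu => h u δ fun x y => hu Fin.elim0 x y
  | succ n ih =>
    intro u δ hu
    have hcell := fun i => ih (u.comp (F i)) δ fun ω x y => by
      have := hu (Fin.cons i ω) x y
      rwa [wordMap_cons, wordMap_cons] at this
    choose v hv hb hd using hcell
    obtain ⟨w, hw⟩ := exists_glue v fun i j => by
      rw [hb, hb, ContinuousMap.comp_apply, ContinuousMap.comp_apply, F_vertex_comm]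
    have hw' : ∀ i x, w (F i x) = v i x := fun i x => DFunLike.congr_fun (hw i) x
    refine ⟨w, mem_finiteEnergySubmodule_of_comp fun i => hw i ▸ hv i, fun i => ?_, fun x => ?_⟩
    · rw [← F_vertex_self i, hw', hb, ContinuousMap.comp_apply]
    · obtain ⟨i, y, rfl⟩ := exists_F_eq x
      rw [hw']
      exact hd i y

theorem exists_finiteEnergy_near (u : C(K, ℝ)) {ε : ℝ} (hε : 0 < ε) :
    ∃ v ∈ finiteEnergySubmodule, ∀ x, |u x - v x| < ε := by
  obtain ⟨C, hC, h⟩ := exists_finiteEnergy_spline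
  have hu := CompactSpace.uniformContinuous_of_continuous u.continuous
  obtain ⟨δ, hδ, hd⟩ := Metric.uniformContinuous_iff.1 hu (ε / (2 * C)) (by positivity)
  obtain ⟨N, hN⟩ := exists_dist_wordMap_lt hδ
  obtain ⟨v, hv, -, hb⟩ := h N u (ε / (2 * C)) fun ω x y => (hd (hN N le_rfl ω x y)).le
  refine ⟨v, hv, fun x => (hb x).trans_lt ?_⟩
  have : C * (ε / (2 * C)) = ε / 2 := by field_simp
  linarith

theorem dense_finiteEnergySubmodule :
    Dense (finiteEnergySubmodule : Set C(K, ℝ)) := by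
  refine Metric.dense_iff.2 fun u ε hε => ?_
  obtain ⟨v, hv, h⟩ := exists_finiteEnergy_near u hε
  refine ⟨v, ?_, hv⟩
  rw [Metric.mem_ball, dist_comm, ContinuousMap.dist_lt_iff hε]
  exact h

/-! ### Failure of the energy self-similar identity -/

namespace IsNetwork

variable {a b : ℕ → ℝ}

/-- The energy of the network shifted by `m` levels, as a real number. -/
noncomputable def levelValue (a b : ℕ → ℝ) (m : ℕ) (u : C(K, ℝ)) : ℝ :=
  (networkEnergy (fun n => a (m + n)) (fun n => b (m + n)) u).toReal

theorem levelValue_eq_sum (h : IsNetwork a b) (m : ℕ) {u : C(K, ℝ)}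
    (hu : u ∈ finiteEnergySubmodule) :
    levelValue a b m u = ∑ i, levelValue a b (m + 1) (u.comp (F i)) := by
  rw [levelValue, (h.shift m).networkEnergy_eq_sum, ENNReal.toReal_sum]
  · refine Finset.sum_congr rfl fun i _ => ?_
    simp only [levelValue, add_assoc]
  · intro i _
    exact ((h.shift m).shift 1).networkEnergy_ne_top_iff.2 (mem_finiteEnergySubmodule_comp hu i)

theorem levelValue_zero (h : IsNetwork a b) (m : ℕ) : levelValue a b m 0 = 0 := by
  have h0 := (h.shift m).tendsto_graphEnergy (zero_mem finiteEnergySubmodule)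
  refine tendsto_nhds_unique h0 (tendsto_const_nhds.congr fun n => ?_)
  exact (graphEnergy_const _ _ _ 0 n).symm

/-- Extension by zero from the first cell. -/
theorem exists_extension_by_zero {u : C(K, ℝ)} (hu : u ∈ finiteEnergySubmodule)
    (hb : ∀ i, u (vertex i) = 0) :
    ∃ w ∈ finiteEnergySubmodule, (∀ i, w (vertex i) = 0) ∧ w.comp (F 0) = u ∧
      w.comp (F 1) = 0 ∧ w.comp (F 2) = 0 := by
  obtain ⟨w, hw⟩ := exists_glue ![u, 0, 0] (by
    intro i j
    fin_cases i <;> fin_cases j <;> simp [hb])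
  have hw' : ∀ i x, w (F i x) = ![u, 0, 0] i x := fun i x => DFunLike.congr_fun (hw i) x
  refine ⟨w, mem_finiteEnergySubmodule_of_comp fun i => ?_, fun i => ?_, hw 0, hw 1, hw 2⟩
  · rw [hw i]
    fin_cases i
    · exact hu
    · exact zero_mem _
    · exact zero_mem _
  · rw [← F_vertex_self i, hw']
    fin_cases i <;> simp [hb]

/-- The extension `w` of `u` by zero has one nonzero cell, so its energy at level `m` is that of `u`
at level `m + 1`. The hypothesis evaluates the same energy for `m = 0`; for larger `m` the relation
is inherited from `w`, which again vanishes at the boundary. -/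
theorem levelValue_succ (h : IsNetwork a b) {ρ : Fin 3 → ℝ}
    (hρ : ∀ u ∈ finiteEnergySubmodule,
      levelValue a b 0 u = ∑ i, ρ i * levelValue a b 0 (u.comp (F i)))
    (m : ℕ) {u : C(K, ℝ)} (hu : u ∈ finiteEnergySubmodule) (hb : ∀ i, u (vertex i) = 0) :
    levelValue a b (m + 1) u = ρ 0 * levelValue a b m u := by
  induction m generalizing u with
  | zero =>
    obtain ⟨w, hmem, -, hw0, hw1, hw2⟩ := exists_extension_by_zero hu hb
    have e1 := h.levelValue_eq_sum 0 hmem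
    have e2 := hρ w hmem
    simp only [Fin.sum_univ_three, hw0, hw1, hw2, h.levelValue_zero, mul_zero, add_zero] at e1 e2
    rw [← e1, e2]
  | succ m ih =>
    obtain ⟨w, hmem, hwb, hw0, hw1, hw2⟩ := exists_extension_by_zero hu hb
    have e := ih hmem hwb
    rw [h.levelValue_eq_sum _ hmem, h.levelValue_eq_sum m hmem] at e
    simpa only [Fin.sum_univ_three, hw0, hw1, hw2, h.levelValue_zero, add_zero] using e

theorem levelValue_eq_pow (h : IsNetwork a b) {ρ : Fin 3 → ℝ}
    (hρ : ∀ u ∈ finiteEnergySubmodule,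
      levelValue a b 0 u = ∑ i, ρ i * levelValue a b 0 (u.comp (F i)))
    (m : ℕ) {u : C(K, ℝ)} (hu : u ∈ finiteEnergySubmodule) (hb : ∀ i, u (vertex i) = 0) :
    levelValue a b m u = ρ 0 ^ m * levelValue a b 0 u := by
  induction m with
  | zero => simp
  | succ m ih => rw [h.levelValue_succ hρ m hu hb, ih]; ring

theorem le_levelValue (h : IsNetwork a b) (m : ℕ) {u : C(K, ℝ)}
    (hu : u ∈ finiteEnergySubmodule) :
    graphEnergy (a (m + 1)) (b (m + 1)) (b (m + 1)) 0 (u.comp (F 0)) ≤ levelValue a b m u := by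
  refine le_trans ?_ ((h.shift m).graphEnergy_le_toReal
    ((h.shift m).networkEnergy_ne_top_iff.2 hu) 1)
  rw [graphEnergy_succ]
  exact Finset.single_le_sum (f := fun i => graphEnergy (a (m + 1)) (b (m + 1)) (b (m + 1)) 0
    (u.comp (F i))) (fun i _ => h.graphEnergy_nonneg _ _ _) (Finset.mem_univ 0)

/-- The unit jump is along the `a`-edge of the first cell, so its energy at shift `m` is at least `a
(m + 1)`. -/
theorem exists_horizontal : ∃ w ∈ finiteEnergySubmodule, (∀ i, w (vertex i) = 0) ∧
    w (F 0 (vertex 1)) = 1 ∧ w (F 0 (vertex 2)) = 0 := by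
  obtain ⟨e0, e1, e2⟩ := height_vertex
  obtain ⟨t0, t1, t2⟩ := tilt_vertex
  obtain ⟨w, hw⟩ := exists_glue
    ![(1 / 2 : ℝ) • (height + tilt), ContinuousMap.const K 1 - height, 0] (by
      intro i j
      fin_cases i <;> fin_cases j <;> simp [e0, e1, e2, t0, t1, t2] <;> norm_num)
  have hw' : ∀ i x, w (F i x) = ![(1 / 2 : ℝ) • (height + tilt),
    ContinuousMap.const K 1 - height, 0] i x := fun i x => DFunLike.congr_fun (hw i) x
  refine ⟨w, mem_finiteEnergySubmodule_of_comp fun i => ?_, fun i => ?_, ?_, ?_⟩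
  · rw [hw i]
    fin_cases i
    · exact Submodule.smul_mem _ _ (add_mem height_mem tilt_mem)
    · exact sub_mem (const_mem_finiteEnergySubmodule 1) height_mem
    · exact zero_mem _
  · rw [← F_vertex_self i, hw']
    fin_cases i <;> simp [e0, e1, t0]
  · rw [hw']
    simp [e1, t1]
    norm_num
  · rw [hw']
    simp [e2, t2]

/-- Take `min h (1 - h)` with `h` the height: it vanishes at the boundary, and as a `1`-Lipschitz
function of `h` its energy is at most that of `h`. -/
theorem exists_vertical : ∃ v ∈ finiteEnergySubmodule, (∀ i, v (vertex i) = 0) ∧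
    v (F 0 (vertex 1)) = 1 / 3 ∧ ∀ x y, |v x - v y| ≤ |height x - height y| := by
  obtain ⟨e0, e1, e2⟩ := height_vertex
  have hlip : ∀ s t : ℝ, |min s (1 - s) - min t (1 - t)| ≤ |s - t| := by
    intro s t
    refine (abs_min_sub_min_le_max _ _ _ _).trans (max_le le_rfl ?_)
    rw [abs_sub_comm s t]
    exact le_of_eq (by congr 1; ring)
  refine ⟨⟨fun x => min (height x) (1 - height x), by fun_prop⟩,
    mem_finiteEnergySubmodule_of_abs_sub_le height_mem fun x y => hlip _ _, fun i => ?_, ?_,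
    fun x y => hlip _ _⟩
  · fin_cases i <;> simp [e0, e1, e2]
  · simp only [ContinuousMap.coe_mk, height_F.1, e1]
    norm_num

theorem not_exists_renormalization (h : IsNetwork a b) (ρ : Fin 3 → ℝ) :
    ¬ ∀ u ∈ finiteEnergySubmodule,
      levelValue a b 0 u = ∑ i, ρ i * levelValue a b 0 (u.comp (F i)) := by
  intro hρ
  obtain ⟨w, hw, hwb, hw1, hw2⟩ := exists_horizontal
  obtain ⟨v, hv, hvb, hv1, hvh⟩ := exists_vertical
  obtain ⟨C, hC, hab⟩ := h.exists_comparison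
  set ew := levelValue a b 0 w with hew
  set ev := levelValue a b 0 v with hev
  have hlow : ∀ m, 2 ^ m ≤ C * (ρ 0 ^ m * ew) := by
    intro m
    rw [hew, ← h.levelValue_eq_pow hρ m hw hwb]
    have h1 := h.le_levelValue m hw
    rw [graphEnergy_zero] at h1
    simp only [ContinuousMap.comp_apply, hw1, hw2] at h1
    have hb := h.b_pos (m + 1)
    have h2 : a (m + 1) ≤ levelValue a b m w := by
      refine le_trans ?_ h1
      have : 0 ≤ b (m + 1) * (w (F 0 (vertex 0)) - 0) ^ 2 := by positivity
      have : 0 ≤ b (m + 1) * (w (F 0 (vertex 0)) - 1) ^ 2 := by positivity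
      linarith
    calc (2 : ℝ) ^ m ≤ 2 ^ (m + 1) := by gcongr <;> norm_num
      _ ≤ C * a (m + 1) := (hab (m + 1)).2.1
      _ ≤ _ := by gcongr
  have hup : ∀ m, ρ 0 ^ m * ev ≤ 2 * C * (3 / 2) ^ m := by
    intro m
    rw [hev, ← h.levelValue_eq_pow hρ m hv hvb]
    refine ENNReal.toReal_le_of_le_ofReal (by positivity) (networkEnergy_le_ofReal fun n => ?_)
    have hb := h.b_pos (m + n)
    refine (graphEnergy_le_of_abs_sub_le (h.a_pos _).le hb.le hb.le n hvh).trans ?_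
    rw [graphEnergy_height]
    calc 2 * b (m + n) * (2 / 3) ^ n ≤ 2 * (C * (3 / 2) ^ (m + n)) * (2 / 3) ^ n := by
          gcongr
          exact (hab _).2.2.1
      _ = 2 * C * (3 / 2) ^ m * (3 / 2 * (2 / 3)) ^ n := by rw [pow_add, mul_pow]; ring
      _ = _ := by norm_num
  have hev0 : 0 < ev := by
    have h1 := h.le_levelValue 0 hv
    rw [graphEnergy_zero] at h1
    simp only [ContinuousMap.comp_apply, hv1, F_vertex_self, hvb] at h1
    refine lt_of_lt_of_le ?_ h1
    have := h.b_pos (0 + 1)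
    have := h.a_pos (0 + 1)
    positivity
  have hew0 : 0 ≤ ew := ENNReal.toReal_nonneg
  -- Both energies scale by `ρ 0 ^ m`, so their ratio is independent of `m`; the bounds force it to
  -- grow like `(4/3) ^ m`, where `4/3 = 2 / (3/2)`.
  obtain ⟨m, hm⟩ := pow_unbounded_of_one_lt (C * (2 * C) * ew / ev)
    (by norm_num : (1 : ℝ) < 4 / 3)
  rw [div_lt_iff₀ hev0] at hm
  have h32 : (0 : ℝ) < (3 / 2) ^ m := by positivity
  have e : (4 / 3 : ℝ) ^ m * (3 / 2) ^ m = 2 ^ m := by rw [← mul_pow]; norm_num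
  have h1 : 2 ^ m * ev ≤ C * (2 * C) * ew * (3 / 2) ^ m := by
    calc 2 ^ m * ev ≤ C * (ρ 0 ^ m * ew) * ev := by gcongr; exact hlow m
      _ = C * ew * (ρ 0 ^ m * ev) := by ring
      _ ≤ C * ew * (2 * C * (3 / 2) ^ m) :=
          mul_le_mul_of_nonneg_left (hup m) (by positivity)
      _ = _ := by ring
  have h2 := mul_lt_mul_of_pos_right hm h32
  have h3 : (4 / 3 : ℝ) ^ m * ev * (3 / 2) ^ m = 2 ^ m * ev := by rw [← e]; ring
  linarith

end IsNetwork

/-! ### The limit form -/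

theorem continuous_graphEnergy (a b c : ℝ) (n : ℕ) : Continuous (graphEnergy a b c n) := by
  unfold graphEnergy
  refine continuous_finsetSum _ fun ω _ => ?_
  have h := fun x => continuous_eval_const (F := C(K, ℝ)) x
  fun_prop

/-- The bilinear form of the limit energy, by polarization. -/
noncomputable def networkForm (a b : ℕ → ℝ) (u v : C(K, ℝ)) : ℝ :=
  ((networkEnergy a b (u + v)).toReal - (networkEnergy a b (u - v)).toReal) / 4

namespace IsNetwork

variable {a b : ℕ → ℝ}

/-- Polarization of the limit. Bilinearity and symmetry of the limit form then pass over from the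
graph forms. -/
theorem tendsto_graphForm (h : IsNetwork a b) {u v : C(K, ℝ)} (hu : u ∈ finiteEnergySubmodule)
    (hv : v ∈ finiteEnergySubmodule) :
    Tendsto (fun n => graphForm (a n) (b n) (b n) n u v) atTop (𝓝 (networkForm a b u v)) := by
  refine (((h.tendsto_graphEnergy (add_mem hu hv)).sub
    (h.tendsto_graphEnergy (sub_mem hu hv))).div_const 4).congr fun n => ?_
  rw [graphEnergy_add, graphEnergy_sub]
  ring

theorem networkForm_self (h : IsNetwork a b) {u : C(K, ℝ)} (hu : u ∈ finiteEnergySubmodule) :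
    networkForm a b u u = (networkEnergy a b u).toReal :=
  tendsto_nhds_unique (h.tendsto_graphForm hu hu)
    ((h.tendsto_graphEnergy hu).congr fun n => (graphForm_self _ _ _ n u).symm)

theorem networkForm_comm (h : IsNetwork a b) {u v : C(K, ℝ)} (hu : u ∈ finiteEnergySubmodule)
    (hv : v ∈ finiteEnergySubmodule) : networkForm a b u v = networkForm a b v u :=
  tendsto_nhds_unique (h.tendsto_graphForm hu hv)
    ((h.tendsto_graphForm hv hu).congr fun n => graphForm_comm _ _ _ n v u)

theorem networkForm_add_left (h : IsNetwork a b) {u v w : C(K, ℝ)}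
    (hu : u ∈ finiteEnergySubmodule) (hv : v ∈ finiteEnergySubmodule)
    (hw : w ∈ finiteEnergySubmodule) :
    networkForm a b (u + v) w = networkForm a b u w + networkForm a b v w :=
  tendsto_nhds_unique (h.tendsto_graphForm (add_mem hu hv) hw)
    (((h.tendsto_graphForm hu hw).add (h.tendsto_graphForm hv hw)).congr fun n =>
      (graphForm_add_left _ _ _ n u v w).symm)

theorem networkForm_smul_left (h : IsNetwork a b) (t : ℝ) {u w : C(K, ℝ)}
    (hu : u ∈ finiteEnergySubmodule) (hw : w ∈ finiteEnergySubmodule) :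
    networkForm a b (t • u) w = t * networkForm a b u w :=
  tendsto_nhds_unique (h.tendsto_graphForm (Submodule.smul_mem _ t hu) hw)
    (((h.tendsto_graphForm hu hw).const_mul t).congr fun n =>
      (graphForm_smul_left _ _ _ t n u w).symm)

/-- The limit form as a bilinear form on the functions of finite energy. -/
noncomputable def bilinForm (h : IsNetwork a b) :
    finiteEnergySubmodule →ₗ[ℝ] finiteEnergySubmodule →ₗ[ℝ] ℝ :=
  LinearMap.mk₂ ℝ (fun u v => networkForm a b u v)
    (fun u v w => h.networkForm_add_left u.2 v.2 w.2)
    (fun t u w => h.networkForm_smul_left t u.2 w.2)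
    (fun u v w => by
      rw [h.networkForm_comm u.2 (v + w).2, h.networkForm_comm u.2 v.2,
        h.networkForm_comm u.2 w.2]
      exact h.networkForm_add_left v.2 w.2 u.2)
    (fun t u w => by
      rw [h.networkForm_comm u.2 (t • w).2, h.networkForm_comm u.2 w.2]
      exact h.networkForm_smul_left t w.2 u.2)

theorem bilinForm_self (h : IsNetwork a b) (u : finiteEnergySubmodule) :
    h.bilinForm u u = (networkEnergy a b u).toReal :=
  h.networkForm_self u.2

theorem bilinForm_self_nonneg (h : IsNetwork a b) (u : finiteEnergySubmodule) :
    0 ≤ h.bilinForm u u := by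
  rw [h.bilinForm_self]
  exact ENNReal.toReal_nonneg

end IsNetwork

/-! ### Continuous functions in `L²` -/

/-- The embedding of `C(K)` into `L²(K, μ)`. -/
noncomputable def toL2 : C(K, ℝ) →ₗ[ℝ] Lp ℝ 2 μ := (ContinuousMap.toLp 2 μ ℝ).toLinearMap

theorem toL2_injective : Function.Injective toL2 := ContinuousMap.toLp_injective μ

theorem continuous_toL2 : Continuous toL2 := (ContinuousMap.toLp 2 μ ℝ).continuous

theorem coeFn_toL2 (u : C(K, ℝ)) : (toL2 u : K → ℝ) =ᵐ[μ] u := ContinuousMap.coeFn_toLp μ u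

/-- At a point minimizing `|u|`, the constant `|u y|` is dominated by `|u|` everywhere, hence also
in `L²`. -/
theorem exists_abs_le_norm_toL2 : ∃ N > 0, ∀ u : C(K, ℝ), ∃ y, |u y| ≤ N * ‖toL2 u‖ := by
  have h1 : 0 < ‖toL2 (ContinuousMap.const K 1)‖ := by
    rw [norm_pos_iff]
    intro h
    have := toL2_injective (h.trans (map_zero _).symm)
    exact one_ne_zero (DFunLike.congr_fun this (vertex 0))
  refine ⟨‖toL2 (ContinuousMap.const K 1)‖⁻¹, by positivity, fun u => ?_⟩
  obtain ⟨y, -, hy⟩ := isCompact_univ.exists_isMinOn ⟨vertex 0, trivial⟩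
    (continuous_abs.comp u.continuous).continuousOn
  refine ⟨y, ?_⟩
  rw [inv_mul_eq_div, le_div_iff₀ h1]
  have e : |u y| * ‖toL2 (ContinuousMap.const K 1)‖ = ‖toL2 (ContinuousMap.const K |u y|)‖ := by
    have : ContinuousMap.const K |u y| = |u y| • ContinuousMap.const K (1 : ℝ) := by
      ext; simp
    rw [this, map_smul, norm_smul, Real.norm_eq_abs, abs_abs]
  rw [e]
  refine Lp.norm_le_norm_of_ae_le ?_
  filter_upwards [coeFn_toL2 (ContinuousMap.const K |u y|), coeFn_toL2 u] with x h1 h2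
  rw [h1, h2, ContinuousMap.const_apply, Real.norm_eq_abs, Real.norm_eq_abs, abs_abs]
  exact hy (Set.mem_univ x)

namespace IsNetwork

variable {a b : ℕ → ℝ}

/-- The oscillation is controlled by the energy and one value by the `L²` norm. Hence the form norm
dominates the uniform norm. -/
theorem exists_norm_le (h : IsNetwork a b) : ∃ C > 0, ∀ u ∈ finiteEnergySubmodule,
    ‖u‖ ≤ C * (√(networkEnergy a b u).toReal + ‖toL2 u‖) := by
  obtain ⟨B, hB, h1⟩ := h.exists_abs_sub_le
  obtain ⟨N, hN, h2⟩ := exists_abs_le_norm_toL2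
  refine ⟨B + N, by positivity, fun u hu => ?_⟩
  rw [ContinuousMap.norm_le _ (by positivity)]
  intro x
  obtain ⟨y, hy⟩ := h2 u
  have h3 := h1 u _ (fun k => h.graphEnergy_le_toReal (h.networkEnergy_ne_top_iff.2 hu) k) x y
  have h4 : |u x| ≤ |u x - u y| + |u y| := by
    simpa using abs_add_le (u x - u y) (u y)
  have h5 : 0 ≤ B * ‖toL2 u‖ := by positivity
  have h6 : 0 ≤ N * √(networkEnergy a b u).toReal := by positivity
  rw [Real.norm_eq_abs]
  linarith

/-- Completeness of the functions of finite energy. -/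
theorem exists_tendsto (h : IsNetwork a b) (s : ℕ → finiteEnergySubmodule)
    (hs : ∀ ε > 0, ∃ N, ∀ j ≥ N, ∀ k ≥ N,
      h.bilinForm (s j - s k) (s j - s k) + ‖toL2 (s j - s k : finiteEnergySubmodule)‖ ^ 2 < ε) :
    ∃ u : finiteEnergySubmodule, Tendsto (fun n => h.bilinForm (s n - u) (s n - u) +
      ‖toL2 (s n - u : finiteEnergySubmodule)‖ ^ 2) atTop (𝓝 0) := by
  obtain ⟨C, hC, hnorm⟩ := h.exists_norm_le
  have hcauchy : CauchySeq fun n => (s n : C(K, ℝ)) := by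
    rw [Metric.cauchySeq_iff]
    intro ε hε
    obtain ⟨N, hN⟩ := hs ((ε / (2 * C)) ^ 2) (by positivity)
    refine ⟨N, fun j hj k hk => ?_⟩
    have h1 := hN j hj k hk
    have h2 := hnorm _ (s j - s k).2
    have h3 := h.bilinForm_self_nonneg (s j - s k)
    rw [dist_eq_norm]
    rw [h.bilinForm_self] at h1 h3
    have e1 : √(networkEnergy a b (s j - s k : finiteEnergySubmodule)).toReal < ε / (2 * C) := by
      rw [Real.sqrt_lt' (by positivity)]
      nlinarith [sq_nonneg ‖toL2 (s j - s k : finiteEnergySubmodule)‖]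
    have e2 : ‖toL2 (s j - s k : finiteEnergySubmodule)‖ < ε / (2 * C) :=
      lt_of_pow_lt_pow_left₀ 2 (by positivity) (by linarith)
    refine h2.trans_lt ?_
    calc _ < C * (ε / (2 * C) + ε / (2 * C)) := by gcongr
      _ = ε := by field_simp; ring
  obtain ⟨u, hu⟩ := cauchySeq_tendsto_of_complete hcauchy
  -- Lower semicontinuity: for fixed `n` the graph energy is continuous for the uniform norm, so the
  -- Cauchy bound survives `k → ∞` uniformly in `n`.
  have hbound : ∀ ε > 0, ∃ N, ∀ j ≥ N, ∀ n,
      graphEnergy (a n) (b n) (b n) n (s j - u) ≤ ε := by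
    intro ε hε
    obtain ⟨N, hN⟩ := hs ε hε
    refine ⟨N, fun j hj n => ?_⟩
    have ht : Tendsto (fun k => graphEnergy (a n) (b n) (b n) n (s j - s k)) atTop
        (𝓝 (graphEnergy (a n) (b n) (b n) n (s j - u))) :=
      ((continuous_graphEnergy _ _ _ n).tendsto _).comp (hu.const_sub _)
    refine le_of_tendsto ht (eventually_atTop.2 ⟨N, fun k hk => ?_⟩)
    have h1 := hN j hj k hk
    rw [h.bilinForm_self] at h1
    have h2 := h.graphEnergy_le_toReal
      (h.networkEnergy_ne_top_iff.2 (s j - s k).2) n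
    have h3 := sq_nonneg ‖toL2 (s j - s k : finiteEnergySubmodule)‖
    exact h2.trans (by linarith)
  have humem : u ∈ finiteEnergySubmodule := by
    obtain ⟨N, hN⟩ := hbound 1 one_pos
    have h1 : (s N : C(K, ℝ)) - u ∈ finiteEnergySubmodule :=
      h.networkEnergy_ne_top_iff.1 (ne_top_of_le_ne_top ENNReal.ofReal_ne_top
        (networkEnergy_le_ofReal (hN N le_rfl)))
    simpa using sub_mem (s N).2 h1
  refine ⟨⟨u, humem⟩, ?_⟩
  have hE : Tendsto (fun n => h.bilinForm (s n - ⟨u, humem⟩) (s n - ⟨u, humem⟩)) atTop (𝓝 0) := by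
    rw [Metric.tendsto_atTop]
    intro ε hε
    obtain ⟨N, hN⟩ := hbound (ε / 2) (by positivity)
    refine ⟨N, fun j hj => ?_⟩
    rw [Real.dist_0_eq_abs, abs_of_nonneg (h.bilinForm_self_nonneg _), h.bilinForm_self]
    exact (ENNReal.toReal_le_of_le_ofReal (by positivity)
      (networkEnergy_le_ofReal (hN j hj))).trans_lt (half_lt_self hε)
  have hL : Tendsto (fun n => ‖toL2 ((s n : C(K, ℝ)) - u)‖ ^ 2) atTop (𝓝 0) := by
    have h1 : Tendsto (fun n => (s n : C(K, ℝ)) - u) atTop (𝓝 0) := by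
      simpa using hu.sub_const u
    have h2 : Tendsto (fun n => toL2 ((s n : C(K, ℝ)) - u)) atTop (𝓝 (toL2 0)) :=
      (continuous_toL2.tendsto 0).comp h1
    have h3 := h2.norm.pow 2
    rwa [map_zero, norm_zero, zero_pow two_ne_zero] at h3
  simpa using hE.add hL

end IsNetwork

/-! ### The Dirichlet form -/

/-- The domain of the Dirichlet form. -/
noncomputable def formDomain : Submodule ℝ (Lp ℝ 2 μ) := finiteEnergySubmodule.map toL2

/-- The continuous representative of an element of the domain. -/
noncomputable def representative : formDomain ≃ₗ[ℝ] finiteEnergySubmodule :=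
  (Submodule.equivMapOfInjective toL2 toL2_injective finiteEnergySubmodule).symm

theorem toL2_representative (u : formDomain) :
    toL2 (representative u) = (u : Lp ℝ 2 μ) :=
  (Submodule.coe_equivMapOfInjective_apply toL2 toL2_injective finiteEnergySubmodule
    (representative u)).symm.trans (congrArg Subtype.val (LinearEquiv.apply_symm_apply
      (Submodule.equivMapOfInjective toL2 toL2_injective finiteEnergySubmodule) u))

theorem representative_eq {u : C(K, ℝ)} (hu : u ∈ finiteEnergySubmodule)
    (hu' : toL2 u ∈ formDomain) : representative ⟨toL2 u, hu'⟩ = ⟨u, hu⟩ := by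
  apply Subtype.ext
  exact toL2_injective (toL2_representative _)

theorem dense_formDomain : Dense (formDomain : Set (Lp ℝ 2 μ)) := by
  have h : DenseRange toL2 := ContinuousMap.toLp_denseRange ℝ μ ℝ (by simp)
  exact h.dense_image continuous_toL2 dense_finiteEnergySubmodule

/-- The Dirichlet form of a network. -/
noncomputable def IsNetwork.dirichletForm {a b : ℕ → ℝ} (h : IsNetwork a b) :
    DirichletForm K μ where
  domain := formDomain
  form := h.bilinForm.compl₁₂ representative.toLinearMap representative.toLinearMap
  dense_domain := dense_formDomain
  symm u v := h.networkForm_comm (representative u).2 (representative v).2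
  nonneg u := h.bilinForm_self_nonneg _
  closed s hs := by
    have hn : ∀ u : formDomain, ‖u‖ = ‖toL2 (representative u)‖ := fun u => by
      rw [toL2_representative]; rfl
    have hf : ∀ u : formDomain, h.bilinForm.compl₁₂ representative.toLinearMap
        representative.toLinearMap u u = h.bilinForm (representative u) (representative u) :=
      fun u => rfl
    obtain ⟨u, hu⟩ := h.exists_tendsto (fun n => representative (s n)) (by
      intro ε hε
      obtain ⟨N, hN⟩ := hs ε hε
      refine ⟨N, fun j hj k hk => ?_⟩
      have := hN j hj k hk
      rwa [hn, hf, map_sub representative] at this)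
    refine ⟨representative.symm u, hu.congr fun n => ?_⟩
    rw [hn, hf, map_sub representative, LinearEquiv.apply_symm_apply]
  markov u := by
    set f := representative u with hf
    let g : C(K, ℝ) := ⟨fun x => min (max (f.1 x) 0) 1, by fun_prop⟩
    have hlip : ∀ x y, |g x - g y| ≤ |f.1 x - f.1 y| := fun x y =>
      calc |min (max (f.1 x) 0) 1 - min (max (f.1 y) 0) 1|
          ≤ max |max (f.1 x) 0 - max (f.1 y) 0| |1 - 1| := abs_min_sub_min_le_max _ _ _ _
        _ ≤ |f.1 x - f.1 y| := by
          rw [sub_self, abs_zero]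
          refine max_le ((abs_max_sub_max_le_max _ _ _ _).trans ?_) (abs_nonneg _)
          simp
    have hg : g ∈ finiteEnergySubmodule := mem_finiteEnergySubmodule_of_abs_sub_le f.2 hlip
    refine ⟨representative.symm ⟨g, hg⟩, ?_, ?_⟩
    · rw [← toL2_representative u, ← toL2_representative (representative.symm ⟨g, hg⟩),
        LinearEquiv.apply_symm_apply]
      filter_upwards [coeFn_toL2 g, coeFn_toL2 f] with x h1 h2
      rw [h1, h2]
      rfl
    · simp only [LinearMap.compl₁₂_apply, LinearEquiv.coe_coe, LinearEquiv.apply_symm_apply]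
      rw [h.bilinForm_self, h.bilinForm_self]
      refine ENNReal.toReal_mono (h.networkEnergy_ne_top_iff.2 f.2) (iSup_mono fun n => ?_)
      exact ENNReal.ofReal_le_ofReal (graphEnergy_le_of_abs_sub_le (h.a_pos n).le (h.b_pos n).le
        (h.b_pos n).le n hlip)

theorem mem_supp_toL2 {u : C(K, ℝ)} {x : K} (hx : u x ≠ 0) : x ∈ DirichletForm.supp (toL2 u) := by
  have e : (μ.withDensity fun x => ‖toL2 u x‖ₑ) = μ.withDensity fun x => ‖u x‖ₑ :=
    withDensity_congr_ae ((coeFn_toL2 u).fun_comp fun t => ‖t‖ₑ)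
  rw [DirichletForm.supp, e, Measure.mem_support_iff_forall]
  intro V hV
  rw [pos_iff_ne_zero]
  intro h0
  rw [withDensity_apply_eq_zero (by fun_prop)] at h0
  have ho : IsOpen ({x | u x ≠ 0} ∩ interior V) :=
    (isOpen_ne_fun u.continuous continuous_const).inter isOpen_interior
  refine (ho.measure_pos μ ⟨x, hx, mem_interior_iff_mem_nhds.2 hV⟩).ne'
    (measure_mono_null ?_ h0)
  rintro y ⟨hy1, hy2⟩
  exact ⟨by simpa using hy1, interior_subset hy2⟩

namespace IsNetwork

variable {a b : ℕ → ℝ}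

theorem isRegular_dirichletForm (h : IsNetwork a b) : h.dirichletForm.IsRegular := by
  have hcs : ∀ f : C(K, ℝ), HasCompactSupport f := fun f =>
    HasCompactSupport.of_compactSpace f
  constructor
  · intro u ε hε
    refine ⟨⟨representative u, hcs _⟩, u, ?_, ?_⟩
    · show ((u : Lp ℝ 2 μ) : K → ℝ) =ᵐ[μ] _
      rw [← toL2_representative u]
      exact coeFn_toL2 _
    · simpa using hε
  · intro g ε hε
    obtain ⟨v, hv, h1⟩ := exists_finiteEnergy_near g.toContinuousMap hε
    exact ⟨⟨v, hcs v⟩, ⟨toL2 v, Submodule.mem_map_of_mem hv⟩, coeFn_toL2 v, h1⟩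

/-- Since `μ` charges open sets, the continuous representative `g` equals `k` everywhere on `U`, and
`f` vanishes off its support. Once cells are smaller than the distance from the support to the
complement of `U`, every edge has zero difference for `f` or for `g`, so the graph forms vanish at
all fine levels. -/
theorem networkForm_eq_zero (h : IsNetwork a b) {f g : C(K, ℝ)} (hf : f ∈ finiteEnergySubmodule)
    (hg : g ∈ finiteEnergySubmodule) {U : Set K} {k : ℝ} (hUo : IsOpen U)
    (hu : IsCompact (DirichletForm.supp (toL2 f))) (hsub : DirichletForm.supp (toL2 f) ⊆ U)
    (hk : ∀ᵐ x ∂μ, x ∈ U → toL2 g x = k) : networkForm a b f g = 0 := by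
  have hgk : ∀ x ∈ U, g x = k := by
    have ho : IsOpen (U ∩ {x | g x ≠ k}) :=
      hUo.inter (isOpen_ne_fun g.continuous continuous_const)
    have h0 : μ (U ∩ {x | g x ≠ k}) = 0 := by
      have : ∀ᵐ x ∂μ, x ∉ U ∩ {x | g x ≠ k} := by
        filter_upwards [hk, coeFn_toL2 g] with x h1 h2
        rintro ⟨h3, h4⟩
        exact h4 (h2.symm.trans (h1 h3))
      exact measure_eq_zero_iff_ae_notMem.2 this
    have he := (ho.measure_eq_zero_iff μ).1 h0
    intro x hx
    by_contra hne
    exact (he ▸ (⟨hx, hne⟩ : x ∈ U ∩ {x | g x ≠ k}) : x ∈ (∅ : Set K))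
  obtain ⟨δ, hδ, hth⟩ := hu.exists_thickening_subset_open hUo hsub
  obtain ⟨N, hN⟩ := exists_dist_wordMap_lt hδ
  have hmul : ∀ x y, dist x y < δ → (f x - f y) * (g x - g y) = 0 := by
    intro x y hxy
    have key : ∀ x y : K, dist x y < δ → f x ≠ 0 → g x = g y := by
      intro x y hxy hx
      have hs := mem_supp_toL2 hx
      rw [hgk x (hsub hs), hgk y (hth (Metric.mem_thickening_iff.2 ⟨x, hs, by rwa [dist_comm]⟩))]
    by_cases hx : f x = 0
    · by_cases hy : f y = 0
      · rw [hx, hy, sub_self, zero_mul]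
      · rw [key y x (by rwa [dist_comm]) hy, sub_self, mul_zero]
    · rw [key x y hxy hx, sub_self, mul_zero]
  refine tendsto_nhds_unique (h.tendsto_graphForm hf hg) (tendsto_const_nhds.congr' ?_)
  refine eventually_atTop.2 ⟨N, fun n hn => (Finset.sum_eq_zero fun ω _ => ?_).symm⟩
  rw [hmul _ _ (hN n hn ω _ _), hmul _ _ (hN n hn ω _ _), hmul _ _ (hN n hn ω _ _)]
  ring

theorem isStronglyLocal_dirichletForm (h : IsNetwork a b) : h.dirichletForm.IsStronglyLocal := by
  rintro u v hu - ⟨U, k, hUo, hsub, hk⟩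
  have eu := toL2_representative u
  have ev := toL2_representative v
  exact h.networkForm_eq_zero (representative u).2 (representative v).2 hUo (eu.symm ▸ hu)
    (eu.symm ▸ hsub) (ev.symm ▸ hk)

end IsNetwork

theorem IsNetwork.isFormOf_dirichletForm {a b : ℕ → ℝ} (h : IsNetwork a b) :
    IsFormOf h.dirichletForm (networkEnergy a b) := by
  constructor
  · show ((finiteEnergySubmodule.map toL2 : Submodule ℝ (Lp ℝ 2 μ)) : Set (Lp ℝ 2 μ)) = _
    rw [Submodule.map_coe]
    congr 1
    ext u
    exact h.networkEnergy_ne_top_iff.symm.trans lt_top_iff_ne_top.symm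
  · intro u hu hu'
    have hm : u ∈ finiteEnergySubmodule := h.networkEnergy_ne_top_iff.1 hu.ne
    have e : representative ⟨toL2 u, hu'⟩ = ⟨u, hm⟩ := representative_eq hm hu'
    show h.bilinForm (representative ⟨toL2 u, hu'⟩) (representative ⟨toL2 u, hu'⟩) = _
    rw [e, h.bilinForm_self]

theorem IsNetwork.not_isSelfSimilar {a b : ℕ → ℝ} (h : IsNetwork a b) :
    ¬ IsSelfSimilar (networkEnergy a b) := by
  rintro ⟨r, hr, hE⟩
  have e : ∀ u, levelValue a b 0 u = (networkEnergy a b u).toReal := fun u => by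
    simp only [levelValue, zero_add]
  refine h.not_exists_renormalization (fun i => 1 / r i) fun u hu => ?_
  have hfin : ∀ i, networkEnergy a b (u.comp (F i)) ≠ ∞ := fun i =>
    h.networkEnergy_ne_top_iff.2 (mem_finiteEnergySubmodule_comp hu i)
  rw [e, hE u (h.networkEnergy_ne_top_iff.2 hu).lt_top,
    ENNReal.toReal_sum fun i _ => ENNReal.mul_ne_top ENNReal.ofReal_ne_top (hfin i)]
  refine Finset.sum_congr rfl fun i _ => ?_
  have := hr i
  rw [ENNReal.toReal_mul, ENNReal.toReal_ofReal (by positivity), e]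

/-! ### Transfer from networks to the energies of the recursive construction -/

namespace IsRecursive

variable {x y z : ℕ → ℝ}

theorem levelEnergy_eq (h : IsRecursive x y z) (h0 : y 0 = z 0) (n : ℕ) (u : C(K, ℝ)) :
    levelEnergy x y z n u = graphEnergy (x n / (y n * (2 * x n + y n))) (1 / (2 * x n + y n))
      (1 / (2 * x n + y n)) n u := by
  rw [levelEnergy, h.conductance_a h0, h.conductance_b h0, h.conductance_c h0]

theorem energy_eq (h : IsRecursive x y z) (h0 : y 0 = z 0) (h1 : y 0 < x 0) :
    energy x y z = networkEnergy (fun n => x n / (y n * (2 * x n + y n)))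
      (fun n => 1 / (2 * x n + y n)) := by
  funext u
  refine Tendsto.limUnder_eq (((h.isNetwork h0 h1).tendsto_networkEnergy u).congr fun n => ?_)
  rw [h.levelEnergy_eq h0]

theorem tendsto_levelEnergy (h : IsRecursive x y z) (h0 : y 0 = z 0) (h1 : y 0 < x 0)
    (u : C(K, ℝ)) : Tendsto (fun n => ENNReal.ofReal (levelEnergy x y z n u)) atTop
      (𝓝 (energy x y z u)) := by
  rw [h.energy_eq h0 h1]
  refine ((h.isNetwork h0 h1).tendsto_networkEnergy u).congr fun n => ?_
  rw [h.levelEnergy_eq h0]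

theorem energy_eq_sum (h : IsRecursive x y z) (h0 : y 0 = z 0) (h1 : y 0 < x 0)
    {x' y' z' : ℕ → ℝ} (h' : IsRecursive x' y' z') (hx : x' 0 = x 1) (hy : y' 0 = y 1)
    (hz : z' 0 = z 1) (u : C(K, ℝ)) :
    energy x y z u = ∑ i, energy x' y' z' (u.comp (F i)) := by
  have e0 : y' 0 = z' 0 := by rw [hy, hz, h.y_eq_z h0]
  have e1 : y' 0 < x' 0 := by rw [hx, hy]; exact h.y_lt_x h0 h1 1
  have e := (h.shift 1).unique (h.y_eq_z h0 1) (h.y_lt_x h0 h1 1) h' hx hy hz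
  rw [h.energy_eq h0 h1, h'.energy_eq e0 e1, (h.isNetwork h0 h1).networkEnergy_eq_sum]
  simp only [(e _).1, (e _).2.1]

theorem finiteEnergy_eq (h : IsRecursive x y z) (h0 : y 0 = z 0) (h1 : y 0 < x 0) :
    finiteEnergy (energy x y z) = finiteEnergySubmodule := by
  ext u
  rw [h.energy_eq h0 h1]
  exact lt_top_iff_ne_top.trans (h.isNetwork h0 h1).networkEnergy_ne_top_iff

end IsRecursive

end SG

theorem theorem1p2 :
    -- for every initial data there is exactly one recursive construction
    (∀ x₀ y₀ : ℝ, 0 < y₀ → y₀ < x₀ →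
      ∃! s : ℕ → ℝ × ℝ × ℝ,
        SG.IsRecursive (fun n => (s n).1) (fun n => (s n).2.1) (fun n => (s n).2.2) ∧
          s 0 = (x₀, y₀, y₀)) ∧
    -- the properties of the conductances and of the limit form
    (∀ x y z : ℕ → ℝ, SG.IsRecursive x y z → y 0 < x 0 → y 0 = z 0 →
      ∀ a b c : ℕ → ℝ,
        (∀ n, a n = SG.conductance (x n) (y n) (z n)) →
        (∀ n, b n = SG.conductance (y n) (z n) (x n)) →
        (∀ n, c n = SG.conductance (z n) (x n) (y n)) →
        b 0 < a 0 ∧ b 0 = c 0 ∧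
        (∀ n, a n = x n / (y n * (2 * x n + y n))) ∧
        SG.Comparable a (fun n => 2 ^ n) ∧
        (∀ n, b n = c n ∧ b n = 1 / (2 * x n + y n)) ∧
        SG.Comparable b (fun n => (3 / 2) ^ n) ∧
        (∀ u : C(SG.K, ℝ),
          Filter.Tendsto (fun n => ENNReal.ofReal (SG.levelEnergy x y z n u)) Filter.atTop
            (nhds (SG.energy x y z u))) ∧
        (∃ D : DirichletForm SG.K SG.μ,
          SG.IsFormOf D (SG.energy x y z) ∧ D.IsRegular ∧ D.IsStronglyLocal) ∧
        (∀ x' y' z' : ℕ → ℝ, SG.IsRecursive x' y' z' →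
          x' 0 = x 1 → y' 0 = y 1 → z' 0 = z 1 →
          ∀ u : C(SG.K, ℝ),
            SG.energy x y z u = ∑ i, SG.energy x' y' z' (u.comp (SG.F i))) ∧
        ¬ SG.IsSelfSimilar (SG.energy x y z)) ∧
    -- the domain does not depend on the initial data
    (∀ x y z x' y' z' : ℕ → ℝ,
      SG.IsRecursive x y z → y 0 < x 0 → y 0 = z 0 →
      SG.IsRecursive x' y' z' → y' 0 < x' 0 → y' 0 = z' 0 →
      SG.finiteEnergy (SG.energy x y z) = SG.finiteEnergy (SG.energy x' y' z')) := by
  refine ⟨fun x₀ y₀ hy hx => SG.existsUnique_isRecursive hy hx, ?_, ?_⟩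
  · intro x y z h h1 h0 a b c ha hb hc
    have ha' : a = fun n => x n / (y n * (2 * x n + y n)) :=
      funext fun n => (ha n).trans (h.conductance_a h0 n)
    have hb' : b = fun n => 1 / (2 * x n + y n) :=
      funext fun n => (hb n).trans (h.conductance_b h0 n)
    have hc' : c = fun n => 1 / (2 * x n + y n) :=
      funext fun n => (hc n).trans (h.conductance_c h0 n)
    have hN := h.isNetwork h0 h1
    have hE := h.energy_eq h0 h1
    subst ha' hb' hc'
    refine ⟨?_, rfl, fun n => rfl, hN.a_comparable, fun n => ⟨rfl, rfl⟩, hN.b_comparable,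
      h.tendsto_levelEnergy h0 h1, ⟨hN.dirichletForm, hE ▸ hN.isFormOf_dirichletForm,
        hN.isRegular_dirichletForm, hN.isStronglyLocal_dirichletForm⟩,
      fun x' y' z' h' hx hy hz u => h.energy_eq_sum h0 h1 h' hx hy hz u,
      hE ▸ hN.not_isSelfSimilar⟩
    have hx0 := h.x_pos 0
    have hy0 := h.y_pos 0
    show 1 / (2 * x 0 + y 0) < x 0 / (y 0 * (2 * x 0 + y 0))
    rw [div_lt_div_iff₀ (by positivity) (by positivity)]
    nlinarith
  · intro x y z x' y' z' h h1 h0 h' h1' h0'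
    rw [h.finiteEnergy_eq h0 h1, h'.finiteEnergy_eq h0' h1']
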